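/- There are absolute constants $C,c>0$ such that the following holds. Let $Q\ge N\ge 2$ be real numbers and let $\mathcal S$ be a set of square-free integers in $[Q,2Q]$ such that $$\frac N2\le\sum_{q\in\mathcal S}\frac{\varphi(q)}q\le N,$$ where $\varphi$ is Euler's totient function. Then $$\sum_{q,r\in\mathcal S}\frac{\varphi(q)\varphi(r)}{qr}\exp\Bigg(\sum_{\substack{p\mid qr/\gcd(q,r)^2\\ p>Q/(N\gcd(q,r))}}\frac1p\Bigg)\le C\,N^2,$$ where the inner sum is over primes $p$. Consequently, if for each $q\in\mathcal S$ we set $\Delta_q=1/(qN)$ and $$\mathcal A_q^*=[0,1]\cap\bigcup_{\substack{0\le a\le q\\ \gcd(a,q)=1}}\Big(\frac aq-\Delta_q,\ \frac aq+\Delta_q\Big),$$ then the Lebesgue measure of $\bigcup_{q\in\mathcal S}\mathcal A_q^*$ is at least $c$. -/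

import Mathlib

/-- For margins of error `Δ : ℕ → ℝ`, the set `𝒜*_q` of points `x ∈ [0,1]` with
`|x - a/q| < Δ_q` for some `0 ≤ a ≤ q` coprime to `q`. -/
def reducedApproxSet (Δ : ℕ → ℝ) (q : ℕ) : Set ℝ :=
  Set.Icc 0 1 ∩
    ⋃ a ∈ {a : ℕ | a ≤ q ∧ Nat.gcd a q = 1},
      Set.Ioo ((a : ℝ) / (q : ℝ) - Δ q) ((a : ℝ) / (q : ℝ) + Δ q)

/-- The sum of `1 / p` over the primes `p` that divide `n` and exceed `z`. -/
noncomputable def primeRecipSum (n : ℕ) (z : ℝ) : ℝ :=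
  ∑ p ∈ n.primeFactors with z < ((p : ℕ) : ℝ), 1 / (p : ℝ)

/-! A square-free integer is encoded by its set of primes, with weight `density` for φ(q)/q. The
core is the bilinear inequality `exists_bilinearBound`. Call (v, w) an edge if its gcd is at least D
and the primes p > t dividing exactly one of the two have reciprocal sum at least K. For families V,
W with products bounded by X and Y, the edges weigh at most C (μ(V) μ(W))^(3/4) (X Y D⁻²
e^(-tK))^(1/4).

Consider a minimal counterexample and split both families according to a prime p. The scale X Y D⁻²
e^(-tK) is unchanged if p is removed from both sides, and drops to at most 3/p of itself if p is
removed from one side. By `two_point_le`, failure of the inequality forces one of the two diagonal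
pieces (p in both, p in neither) to carry only O(p^(-3/2)) of the critical value. This is summable,
so beyond a fixed p₀ at least half of the edge weight avoids every rare piece at once: there is a
set T of primes such that v and w never both differ from T at a prime ≥ p₀. The gcd is then
essentially ∏T / (∏(T \ v) ∏(T \ w)), the sum over edges factorises, and Rankin's trick bounds it by
a constant times the scale (`structured_edgeMass_le`). Interpolation with the trivial bound μ(V)
μ(W) is a contradiction.

For the second moment, use t = 2^j, K = 20 and D = Q/(N e^(6t)): such edges weigh O(N² e^(-2t)). A
pair with large reciprocal sum is an edge at some scale 2^j with sum at most 22 + j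
(`recipSum_dichotomy`), and e^j is negligible against e^(2·2^j). This even covers all primes above
log(Q/(N gcd))/6. That stronger form matters for the measure: it lets overlaps be bounded
(`exists_overlap_le`) by an elementary sieve that counts whole periods modulo a primorial. A
Chung–Erdős inequality then bounds the union from below. -/

namespace DuffinSchaeffer

open Finset

/-! ### A two-point inequality -/

/-- Since ab = cd, the normalisation reads (a² + b²)² + (c² - d²)² = 1. Write 1 - a³ - b³ as (1 - a²
- b²) + a²(1 - a) + b²(1 - b): the first term is at least (c² - d²)²/2, and b ≤ 71/100 makes the
last at least (29/100)(ab)². As (c² + d²)² = (c² - d²)² + 4(ab)², the constant 7/100 suffices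
because 4 · 7 ≤ 29. -/
theorem one_sub_cube_sum_lower_bound {a b c d : ℝ} (ha : 0 ≤ a) (hb : 0 ≤ b)
    (hba : b ≤ a) (hsum : a ^ 4 + b ^ 4 + c ^ 4 + d ^ 4 = 1) (hmul : a * b = c * d) :
    (c ^ 2 + d ^ 2) ^ 2 * (7 / 100) ≤ 1 - a ^ 3 - b ^ 3 := by
  have hS : (a ^ 2 + b ^ 2) ^ 2 + (c ^ 2 - d ^ 2) ^ 2 = 1 := by
    linear_combination hsum + (2 * a * b + 2 * c * d) * hmul
  have hR : (c ^ 2 + d ^ 2) ^ 2 = (c ^ 2 - d ^ 2) ^ 2 + 4 * (a * b) ^ 2 := by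
    rw [hmul]; ring
  have hS1 : a ^ 2 + b ^ 2 ≤ 1 := by
    nlinarith [sq_nonneg (c ^ 2 - d ^ 2), sq_nonneg a, sq_nonneg b]
  have ha1 : a ≤ 1 := by nlinarith
  have hb1 : b ≤ 71 / 100 := by nlinarith
  have hab : (a * b) ^ 2 ≤ b ^ 2 := by
    rw [mul_pow]; nlinarith [sq_nonneg b, sq_nonneg a]
  have h1 : 0 ≤ a ^ 2 * (1 - a) := mul_nonneg (sq_nonneg a) (by linarith)
  have h2 : b ^ 2 * (29 / 100) ≤ b ^ 2 * (1 - b) :=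
    mul_le_mul_of_nonneg_left (by linarith) (sq_nonneg b)
  have h3 : (c ^ 2 - d ^ 2) ^ 2 / 2 ≤ 1 - (a ^ 2 + b ^ 2) := by
    nlinarith [sq_nonneg (1 - (a ^ 2 + b ^ 2))]
  nlinarith [sq_nonneg (c ^ 2 - d ^ 2)]

theorem cube_sum_le_of_sq_sum {c d r : ℝ} (hr : 0 ≤ r)
    (h : c ^ 2 + d ^ 2 = r ^ 2) : c ^ 3 + d ^ 3 ≤ r ^ 3 := by
  have hcr : c ≤ r := by nlinarith [sq_nonneg d]
  have hdr : d ≤ r := by nlinarith [sq_nonneg c]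
  calc c ^ 3 + d ^ 3 = c ^ 2 * c + d ^ 2 * d := by ring
    _ ≤ c ^ 2 * r + d ^ 2 * r := by gcongr
    _ = (c ^ 2 + d ^ 2) * r := by ring
    _ = r ^ 3 := by rw [h]; ring

/-- The deficit 1 - a³ - b³ is at least 0.07 r⁴ with r² = c² + d², while the off-diagonal terms
restore at most ε r³; hence r ≤ 100ε/7 and r² ≤ 205 ε². Then a ≥ 1/2, and b/2 ≤ ab = cd ≤ r²/2. -/
theorem two_point_le {a b c d ε : ℝ} (ha : 0 ≤ a) (hb : 0 ≤ b)
    (hε0 : 0 ≤ ε) (hε : ε ≤ 1 / 25) (hba : b ≤ a)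
    (hsum : a ^ 4 + b ^ 4 + c ^ 4 + d ^ 4 = 1) (hmul : a * b = c * d)
    (h : 1 ≤ a ^ 3 + b ^ 3 + ε * (c ^ 3 + d ^ 3)) : b ≤ 205 * ε ^ 2 := by
  have key := one_sub_cube_sum_lower_bound ha hb hba hsum hmul
  set r := √(c ^ 2 + d ^ 2) with hr
  have hr0 : 0 ≤ r := Real.sqrt_nonneg _
  have hr2 : c ^ 2 + d ^ 2 = r ^ 2 := (Real.sq_sqrt (by positivity)).symm
  have hcube := cube_sum_le_of_sq_sum hr0 hr2
  have h4 : r ^ 4 * (7 / 100) ≤ ε * r ^ 3 := by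
    have := mul_le_mul_of_nonneg_left hcube hε0
    rw [hr2, ← pow_mul] at key
    linarith
  have hrε : r * (7 / 100) ≤ ε := by
    rcases hr0.eq_or_lt with h0 | h0
    · rw [← h0]; simpa using hε0
    · have : r ^ 3 * (r * (7 / 100)) ≤ r ^ 3 * ε := by nlinarith
      exact le_of_mul_le_mul_left this (by positivity)
  have hR : c ^ 2 + d ^ 2 ≤ 205 * ε ^ 2 := by
    rw [hr2]
    have h1 : (r * (7 / 100)) ^ 2 ≤ ε ^ 2 := by gcongr
    have h2 : (r * (7 / 100)) ^ 2 = r ^ 2 * (49 / 10000) := by ring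
    linarith [sq_nonneg r]
  have hR2 : c ^ 2 + d ^ 2 ≤ 1 / 2 := by
    have : ε ^ 2 ≤ (1 / 25) ^ 2 := by gcongr
    linarith
  have hS : (a ^ 2 + b ^ 2) ^ 2 + (c ^ 2 - d ^ 2) ^ 2 = 1 := by
    linear_combination hsum + (2 * a * b + 2 * c * d) * hmul
  have hcd : (c ^ 2 - d ^ 2) ^ 2 ≤ 1 / 4 := by
    have h1 : (c ^ 2 + d ^ 2) ^ 2 ≤ (1 / 2) ^ 2 := by gcongr
    have h2 : (c ^ 2 - d ^ 2) ^ 2 = (c ^ 2 + d ^ 2) ^ 2 - 4 * (c * d) ^ 2 := by ring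
    have h3 : 0 ≤ (c * d) ^ 2 := sq_nonneg _
    linarith
  have hS3 : 3 / 4 ≤ a ^ 2 + b ^ 2 := by
    by_contra! hlt
    have : (a ^ 2 + b ^ 2) ^ 2 < (3 / 4) ^ 2 := pow_lt_pow_left₀ hlt (by positivity) two_ne_zero
    linarith
  have hb2 : b ^ 2 ≤ a ^ 2 := by gcongr
  have ha2 : 1 / 2 ≤ a := by
    by_contra! hlt
    have : a ^ 2 < (1 / 2) ^ 2 := pow_lt_pow_left₀ hlt ha two_ne_zero
    linarith
  have h5 : 2 * (c * d) ≤ c ^ 2 + d ^ 2 := by linarith [sq_nonneg (c - d), sub_sq c d]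
  have h6 : 1 / 2 * b ≤ a * b := by gcongr
  linarith

/-! ### Fourth roots -/

/-- The fourth root of a real number. -/
noncomputable def fourthRoot (x : ℝ) : ℝ := √(√x)

theorem fourthRoot_nonneg (x : ℝ) : 0 ≤ fourthRoot x := Real.sqrt_nonneg _

theorem fourthRoot_pow {x : ℝ} (hx : 0 ≤ x) : fourthRoot x ^ 4 = x := by
  rw [fourthRoot, show (4 : ℕ) = 2 * 2 from rfl, pow_mul, Real.sq_sqrt (Real.sqrt_nonneg _),
    Real.sq_sqrt hx]

theorem fourthRoot_mul {x : ℝ} (hx : 0 ≤ x) (y : ℝ) :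
    fourthRoot (x * y) = fourthRoot x * fourthRoot y := by
  rw [fourthRoot, Real.sqrt_mul hx, Real.sqrt_mul (Real.sqrt_nonneg _)]; rfl

theorem fourthRoot_mono {x y : ℝ} (h : x ≤ y) : fourthRoot x ≤ fourthRoot y :=
  Real.sqrt_le_sqrt (Real.sqrt_le_sqrt h)

theorem fourthRoot_pos {x : ℝ} (hx : 0 < x) : 0 < fourthRoot x :=
  Real.sqrt_pos.2 (Real.sqrt_pos.2 hx)

theorem fourthRoot_pow_four {x : ℝ} (hx : 0 ≤ x) : fourthRoot (x ^ 4) = x := by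
  rw [fourthRoot, show x ^ 4 = (x ^ 2) ^ 2 by ring, Real.sqrt_sq (by positivity), Real.sqrt_sq hx]

theorem fourthRoot_one : fourthRoot 1 = 1 := by simp [fourthRoot]

/-! ### Squarefree integers as finite sets of primes -/

/-- The integer (as a real number) that is the product of the elements of `u`. -/
noncomputable def setProd (u : Finset ℕ) : ℝ := ∏ p ∈ u, (p : ℝ)

/-- The weight `φ(n) / n` of the squarefree integer `n` with set of prime factors `u`. -/
noncomputable def density (u : Finset ℕ) : ℝ := ∏ p ∈ u, (1 - 1 / (p : ℝ))

/-- The sum of `1 / p` over the elements `p > t` of `u`. -/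
noncomputable def recipSum (t : ℝ) (u : Finset ℕ) : ℝ := ∑ p ∈ u with t < (p : ℕ), 1 / (p : ℝ)

/-- The local factor `exp (t / p)` for `p > t`, and `1` for `p ≤ t`. -/
noncomputable def rankinFactor (t : ℝ) (p : ℕ) : ℝ := if t < p then Real.exp (t / p) else 1

/-- The multiplicative weight `exp (t * recipSum t u)`. -/
noncomputable def rankinWeight (t : ℝ) (u : Finset ℕ) : ℝ := ∏ p ∈ u, rankinFactor t p

/-- `u` consists of primes. -/
def IsPrimeSet (u : Finset ℕ) : Prop := ∀ p ∈ u, p.Prime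

theorem IsPrimeSet.mono {u v : Finset ℕ} (hv : IsPrimeSet v) (h : u ⊆ v) : IsPrimeSet u :=
  fun p hp => hv p (h hp)

theorem IsPrimeSet.setProd_pos {u : Finset ℕ} (hu : IsPrimeSet u) : 0 < setProd u :=
  prod_pos fun p hp => by exact_mod_cast (hu p hp).pos

theorem IsPrimeSet.one_le_setProd {u : Finset ℕ} (hu : IsPrimeSet u) : 1 ≤ setProd u := by
  have : (1 : ℝ) = ∏ p ∈ u, (1 : ℝ) := by simp
  rw [this]
  exact prod_le_prod (fun _ _ => zero_le_one) fun p hp => by exact_mod_cast (hu p hp).one_le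

theorem one_sub_inv_prime_pos {p : ℕ} (hp : p.Prime) : 0 < 1 - 1 / (p : ℝ) := by
  have : (1 : ℝ) < p := by exact_mod_cast hp.one_lt
  rw [sub_pos, div_lt_one (by linarith)]; exact this

theorem one_sub_inv_prime_le_one (p : ℕ) : 1 - 1 / (p : ℝ) ≤ 1 := by
  have : 0 ≤ 1 / (p : ℝ) := by positivity
  linarith

theorem IsPrimeSet.density_pos {u : Finset ℕ} (hu : IsPrimeSet u) : 0 < density u :=
  prod_pos fun p hp => one_sub_inv_prime_pos (hu p hp)

theorem IsPrimeSet.density_le_one {u : Finset ℕ} (hu : IsPrimeSet u) : density u ≤ 1 :=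
  prod_le_one (fun p hp => (one_sub_inv_prime_pos (hu p hp)).le)
    fun p _ => one_sub_inv_prime_le_one p

theorem IsPrimeSet.density_anti {u v : Finset ℕ} (hv : IsPrimeSet v) (h : u ⊆ v) :
    density v ≤ density u := by
  rw [density, ← prod_sdiff h]
  exact mul_le_of_le_one_left (hv.mono h).density_pos.le (hv.mono sdiff_subset).density_le_one

theorem recipSum_mono (t : ℝ) {u v : Finset ℕ} (h : u ⊆ v) : recipSum t u ≤ recipSum t v :=
  sum_le_sum_of_subset_of_nonneg (filter_subset_filter _ h) fun _ _ _ => by positivity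

theorem recipSum_insert (t : ℝ) {p : ℕ} {u : Finset ℕ} (hp : p ∉ u) :
    recipSum t (insert p u) = (if t < p then 1 / (p : ℝ) else 0) + recipSum t u := by
  simp only [recipSum, sum_filter]
  rw [sum_insert hp]

theorem recipSum_union_le (t : ℝ) (u v : Finset ℕ) :
    recipSum t (u ∪ v) ≤ recipSum t u + recipSum t v := by
  simp only [recipSum, filter_union]
  rw [← sum_union_inter]
  exact le_add_of_nonneg_right (sum_nonneg fun _ _ => by positivity)

theorem rankinWeight_eq (t : ℝ) (u : Finset ℕ) :
    rankinWeight t u = Real.exp (t * recipSum t u) := by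
  rw [recipSum, sum_filter, mul_sum, Real.exp_sum, rankinWeight]
  refine prod_congr rfl fun p _ => ?_
  rw [rankinFactor]
  split_ifs
  · rw [mul_one_div]
  · simp

theorem one_le_rankinFactor {t : ℝ} (ht : 0 ≤ t) (p : ℕ) : 1 ≤ rankinFactor t p := by
  rw [rankinFactor]
  split_ifs
  · exact Real.one_le_exp (by positivity)
  · rfl

theorem rankinWeight_pos (t : ℝ) (u : Finset ℕ) : 0 < rankinWeight t u := by
  rw [rankinWeight_eq]; positivity

theorem rankinWeight_union (t : ℝ) {u v : Finset ℕ} (h : Disjoint u v) :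
    rankinWeight t (u ∪ v) = rankinWeight t u * rankinWeight t v := prod_union h

/-! ### Convergent products -/

theorem sum_inv_sq_gt_le {t : ℝ} (ht : 1 ≤ t) (R : Finset ℕ) :
    ∑ p ∈ R with t < (p : ℕ), (((p : ℝ)) ^ 2)⁻¹ ≤ 2 / t := by
  obtain ⟨n, hn⟩ := R.exists_nat_subset_range
  calc ∑ p ∈ R with t < (p : ℕ), (((p : ℝ)) ^ 2)⁻¹
      ≤ ∑ p ∈ Ioo ⌊t⌋₊ n, (((p : ℝ)) ^ 2)⁻¹ := by
        refine sum_le_sum_of_subset_of_nonneg (fun p hp => ?_) fun _ _ _ => by positivity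
        rw [mem_filter] at hp
        rw [mem_Ioo, Nat.floor_lt (by linarith)]
        exact ⟨hp.2, mem_range.1 (hn hp.1)⟩
    _ ≤ 2 / (⌊t⌋₊ + 1) := sum_Ioo_inv_sq_le _ _
    _ ≤ 2 / t := by
        gcongr
        exact (Nat.lt_floor_add_one t).le

theorem exp_sub_one_le_two_mul {x : ℝ} (h0 : 0 ≤ x) (h1 : x ≤ 1) : Real.exp x - 1 ≤ 2 * x := by
  have h := Real.norm_exp_sub_one_sub_id_le (x := x) (by rwa [Real.norm_eq_abs, abs_of_nonneg h0])
  rw [Real.norm_eq_abs, Real.norm_eq_abs, sq_abs] at h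
  nlinarith [le_abs_self (Real.exp x - 1 - x)]

/-- For p > t the factor is at most exp(2t/p²), and the sum of p⁻² over p > t is at most 2/t, so the
bound does not depend on t. -/
theorem prod_one_add_rankinFactor_le {t : ℝ} (ht : 1 ≤ t) (R : Finset ℕ) :
    ∏ p ∈ R, (1 + (rankinFactor t p - 1) / p) ≤ Real.exp 4 := by
  have h1 : ∀ p ∈ R, 1 + (rankinFactor t p - 1) / p ≤
      Real.exp (if t < p then 2 * t * ((p : ℝ) ^ 2)⁻¹ else 0) := by
    intro p _
    rw [rankinFactor]
    split_ifs with h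
    · have hp : (0 : ℝ) < p := by linarith
      have h2 := exp_sub_one_le_two_mul (x := t / p) (by positivity)
        ((div_le_one hp).2 h.le)
      calc 1 + (Real.exp (t / p) - 1) / p ≤ 1 + (2 * (t / p)) / p := by gcongr
        _ = 2 * t * ((p : ℝ) ^ 2)⁻¹ + 1 := by field_simp; ring
        _ ≤ _ := Real.add_one_le_exp _
    · simp
  calc ∏ p ∈ R, (1 + (rankinFactor t p - 1) / p)
      ≤ ∏ p ∈ R, Real.exp (if t < p then 2 * t * ((p : ℝ) ^ 2)⁻¹ else 0) :=
        prod_le_prod (fun p _ => by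
          have := one_le_rankinFactor (zero_le_one.trans ht) p
          have : 0 ≤ (rankinFactor t p - 1) / p := div_nonneg (by linarith) (by positivity)
          linarith) h1
    _ = Real.exp (2 * t * ∑ p ∈ R with t < (p : ℕ), (((p : ℝ)) ^ 2)⁻¹) := by
        rw [← Real.exp_sum, ← sum_filter, mul_sum]
    _ ≤ Real.exp 4 := by
        gcongr
        calc _ ≤ 2 * t * (2 / t) := by
              gcongr
              exact sum_inv_sq_gt_le ht R
          _ = 4 := by field_simp; norm_num

/-! ### Counting -/

/-- This counts multiples of ∏m up to Z: by unique factorisation u is recovered from its cofactor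
∏(u \ m). -/
theorem card_superset_le {U : Finset (Finset ℕ)} (hU : ∀ u ∈ U, IsPrimeSet u) {Z : ℝ}
    (hZ0 : 0 ≤ Z) (hZ : ∀ u ∈ U, setProd u ≤ Z) (m : Finset ℕ) :
    ((U.filter (m ⊆ ·)).card : ℝ) ≤ Z / setProd m := by
  have hm0 : 0 ≤ setProd m := prod_nonneg fun _ _ => by positivity
  have hcard : (U.filter (m ⊆ ·)).card ≤ (Ioc 0 ⌊Z / setProd m⌋₊).card := by
    refine card_le_card_of_injOn (fun u => ∏ p ∈ u \ m, p) (fun u hu => ?_) ?_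
    · rw [mem_coe, mem_filter] at hu
      have hpu := hU u hu.1
      rw [mem_coe, mem_Ioc]
      refine ⟨prod_pos fun p hp => ((hpu.mono sdiff_subset) p hp).pos, Nat.le_floor ?_⟩
      rw [Nat.cast_prod, le_div_iff₀ (hpu.mono hu.2).setProd_pos, setProd, prod_sdiff hu.2]
      exact hZ u hu.1
    · intro u hu v hv huv
      rw [mem_coe, mem_filter] at hu hv
      have h1 := Nat.primeFactors_prod ((hU u hu.1).mono (sdiff_subset (t := m)))
      have h2 := Nat.primeFactors_prod ((hU v hv.1).mono (sdiff_subset (t := m)))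
      have h3 : u \ m = v \ m := by
        rw [← h1, ← h2]; exact congrArg _ huv
      rw [← sdiff_union_of_subset hu.2, h3, sdiff_union_of_subset hv.2]
  rw [Nat.card_Ioc, Nat.sub_zero] at hcard
  exact (Nat.cast_le.2 hcard).trans (Nat.floor_le (by positivity))

theorem rankinWeight_expand (t : ℝ) (u : Finset ℕ) :
    rankinWeight t u = ∑ m ∈ u.powerset, ∏ p ∈ m, (rankinFactor t p - 1) := by
  rw [← prod_one_add]
  exact prod_congr rfl fun p _ => by ring

/-- Expand the multiplicative weight over divisors m, count the multiples of each m, and reassemble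
a bounded Euler product. -/
theorem sum_rankinWeight_le {t : ℝ} (ht : 1 ≤ t) {U : Finset (Finset ℕ)}
    (hU : ∀ u ∈ U, IsPrimeSet u) {Z : ℝ} (hZ0 : 0 ≤ Z) (hZ : ∀ u ∈ U, setProd u ≤ Z) :
    ∑ u ∈ U, rankinWeight t u ≤ Real.exp 4 * Z := by
  have ht0 : 0 ≤ t := zero_le_one.trans ht
  set R := U.sup id with hR
  have hsub : ∀ u ∈ U, u ⊆ R := fun u hu => le_sup (f := id) hu
  have hnn : ∀ m : Finset ℕ, 0 ≤ ∏ p ∈ m, (rankinFactor t p - 1) := fun m =>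
    prod_nonneg fun p _ => sub_nonneg.2 (one_le_rankinFactor ht0 p)
  calc ∑ u ∈ U, rankinWeight t u
      = ∑ u ∈ U, ∑ m ∈ R.powerset, if m ⊆ u then ∏ p ∈ m, (rankinFactor t p - 1) else 0 := by
        refine sum_congr rfl fun u hu => ?_
        rw [rankinWeight_expand, ← sum_filter]
        refine sum_congr ?_ fun _ _ => rfl
        ext m
        simp only [mem_powerset, mem_filter]
        exact ⟨fun h => ⟨h.trans (hsub u hu), h⟩, fun h => h.2⟩
    _ = ∑ m ∈ R.powerset, (U.filter (m ⊆ ·)).card * ∏ p ∈ m, (rankinFactor t p - 1) := by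
        rw [sum_comm]
        refine sum_congr rfl fun m _ => ?_
        rw [← sum_filter, sum_const, nsmul_eq_mul]
    _ ≤ ∑ m ∈ R.powerset, Z / setProd m * ∏ p ∈ m, (rankinFactor t p - 1) :=
        sum_le_sum fun m _ =>
          mul_le_mul_of_nonneg_right (card_superset_le hU hZ0 hZ m) (hnn m)
    _ = Z * ∏ p ∈ R, (1 + (rankinFactor t p - 1) / p) := by
        rw [prod_one_add, mul_sum]
        refine sum_congr rfl fun m _ => ?_
        rw [prod_div_distrib, setProd]
        ring
    _ ≤ Z * Real.exp 4 := by
        gcongr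
        exact prod_one_add_rankinFactor_le ht R
    _ = _ := mul_comm _ _

/-- Mass of a family of prime sets, weighted by its distance to a fixed set `T`. -/
theorem sum_density_mul_rankinWeight_symmDiff_le {t : ℝ} (ht : 1 ≤ t) {T : Finset ℕ}
    (hT : IsPrimeSet T) {V : Finset (Finset ℕ)} (hV : ∀ v ∈ V, IsPrimeSet v) {X : ℝ} (hX : 0 ≤ X)
    (hVX : ∀ v ∈ V, setProd v ≤ X) :
    ∑ v ∈ V, density v * rankinWeight t (symmDiff v T) / setProd (T \ v) ^ 2 ≤
      Real.exp 8 * X / setProd T := by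
  have hT0 := hT.setProd_pos
  have hprod : ∀ s ⊆ T, setProd (T \ s) * setProd s = setProd T := fun s hs => prod_sdiff hs
  calc ∑ v ∈ V, density v * rankinWeight t (symmDiff v T) / setProd (T \ v) ^ 2
      -- Fix the set s of primes of T missing from v. Then v is determined by v \ T, whose product
      -- is at most X ∏s / ∏T; the count thus absorbs one of the two factors 1/∏s.
      = ∑ s ∈ T.powerset, ∑ v ∈ V with T \ v = s,
          density v * rankinWeight t (symmDiff v T) / setProd (T \ v) ^ 2 :=
        (sum_fiberwise_of_maps_to (fun v _ => mem_powerset.2 sdiff_subset) _).symm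
    _ ≤ ∑ s ∈ T.powerset, density (T \ s) * rankinWeight t s / setProd s ^ 2 *
          (Real.exp 4 * (X * setProd s / setProd T)) := by
        refine sum_le_sum fun s hs => ?_
        rw [mem_powerset] at hs
        have hs0 := (hT.mono hs).setProd_pos
        calc ∑ v ∈ V with T \ v = s,
              density v * rankinWeight t (symmDiff v T) / setProd (T \ v) ^ 2
            ≤ ∑ v ∈ V with T \ v = s,
              density (T \ s) * rankinWeight t s / setProd s ^ 2 * rankinWeight t (v \ T) := by
              refine sum_le_sum fun v hv => ?_
              rw [mem_filter] at hv
              obtain ⟨hv, rfl⟩ := hv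
              have h1 : symmDiff v T = (T \ v) ∪ (v \ T) := by
                rw [symmDiff_def, sup_comm]; rfl
              have h2 : Disjoint (T \ v) (v \ T) := disjoint_sdiff_sdiff
              rw [h1, rankinWeight_union t h2]
              have h3 : density v ≤ density (T \ (T \ v)) :=
                (hV v hv).density_anti (by rw [sdiff_sdiff_right_self]; exact inter_subset_right)
              have h4 := rankinWeight_pos t (T \ v)
              have h5 := rankinWeight_pos t (v \ T)
              calc _ = density v * (rankinWeight t (T \ v) * rankinWeight t (v \ T)
                        / setProd (T \ v) ^ 2) := by ring
                _ ≤ density (T \ (T \ v)) * (rankinWeight t (T \ v) * rankinWeight t (v \ T)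
                        / setProd (T \ v) ^ 2) := by gcongr
                _ = _ := by ring
          _ = density (T \ s) * rankinWeight t s / setProd s ^ 2 *
                ∑ v ∈ V with T \ v = s, rankinWeight t (v \ T) := by rw [mul_sum]
          _ ≤ _ := by
              have h6 := (hT.mono (sdiff_subset (t := s))).density_pos
              have h7 := rankinWeight_pos t s
              gcongr
              have hinj : Set.InjOn (fun v => v \ T) (V.filter (fun v => T \ v = s)) := by
                intro v hv w hw hvw
                rw [mem_coe, mem_filter] at hv hw
                have h8 : ∀ u : Finset ℕ, u = (u \ T) ∪ (T \ (T \ u)) := fun u => by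
                  ext x; simp only [mem_union, mem_sdiff]; tauto
                rw [h8 v, h8 w, hv.2, hw.2]
                exact congrArg (· ∪ _) hvw
              rw [← sum_image (f := fun u => rankinWeight t u) hinj]
              refine sum_rankinWeight_le ht ?_ (by positivity) ?_
              · intro u hu
                obtain ⟨v, hv, rfl⟩ := mem_image.1 hu
                exact (hV v (mem_filter.1 hv).1).mono sdiff_subset
              · intro u hu
                obtain ⟨v, hv, rfl⟩ := mem_image.1 hu
                rw [mem_filter] at hv
                obtain ⟨hv, rfl⟩ := hv
                have h9 : setProd v = setProd (v \ T) * setProd (v ∩ T) := by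
                  rw [setProd, ← prod_inter_mul_prod_sdiff v T, mul_comm]; rfl
                have h10 : setProd T = setProd (T \ v) * setProd (v ∩ T) := by
                  rw [setProd, ← prod_inter_mul_prod_sdiff T v, mul_comm, inter_comm]; rfl
                have h11 : 0 < setProd (v ∩ T) := ((hV v hv).mono inter_subset_left).setProd_pos
                rw [le_div_iff₀ hT0, h10]
                calc _ = setProd v * setProd (T \ v) := by rw [h9]; ring
                  _ ≤ _ := by
                    gcongr
                    exact hVX v hv
    _ = Real.exp 4 * X / setProd T *
          ∑ s ∈ T.powerset, (∏ p ∈ s, rankinFactor t p / p) * ∏ p ∈ T \ s, (1 - 1 / (p : ℝ)) := by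
        rw [mul_sum]
        refine sum_congr rfl fun s hs => ?_
        have hs0 := (hT.mono (mem_powerset.1 hs)).setProd_pos
        rw [prod_div_distrib]
        change _ = Real.exp 4 * X / setProd T * (rankinWeight t s / setProd s * density (T \ s))
        field_simp
    _ ≤ Real.exp 4 * X / setProd T * Real.exp 4 := by
        -- Keeping `density (T \ s)` is essential: the local factor becomes f/p + 1 - 1/p = 1 + (f -
        -- 1)/p, whose product is bounded, whereas 1 + f/p would diverge.
        rw [← prod_add]
        gcongr
        refine le_of_eq_of_le (prod_congr rfl fun p _ => ?_) (prod_one_add_rankinFactor_le ht T)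
        ring
    _ = _ := by
        rw [show (8 : ℝ) = 4 + 4 by norm_num, Real.exp_add]; ring

/-! ### Pairs with a large common divisor and many small asymmetric primes -/

/-- The pair `(v, w)` has common divisor at least `D` and at least `K` for the sum of the
reciprocals of the primes `p > t` dividing exactly one of the two. -/
def IsEdge (t D K : ℝ) (v w : Finset ℕ) : Prop :=
  D ≤ setProd (v ∩ w) ∧ K ≤ recipSum t (symmDiff v w)

noncomputable instance (t D K : ℝ) (v w : Finset ℕ) : Decidable (IsEdge t D K v w) :=
  Classical.propDecidable _

/-- The total weight of a family. -/
noncomputable def mass (V : Finset (Finset ℕ)) : ℝ := ∑ v ∈ V, density v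

/-- The total weight of the edges between `V` and `W`. -/
noncomputable def edgeMass (t D K : ℝ) (V W : Finset (Finset ℕ)) : ℝ :=
  ∑ v ∈ V, ∑ w ∈ W, if IsEdge t D K v w then density v * density w else 0

theorem IsEdge.comm {t D K : ℝ} {v w : Finset ℕ} : IsEdge t D K v w ↔ IsEdge t D K w v := by
  rw [IsEdge, IsEdge, inter_comm, symmDiff_comm]

theorem edgeMass_comm (t D K : ℝ) (V W : Finset (Finset ℕ)) :
    edgeMass t D K V W = edgeMass t D K W V := by
  rw [edgeMass, sum_comm]
  refine sum_congr rfl fun w _ => sum_congr rfl fun v _ => ?_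
  rw [mul_comm]
  exact if_congr IsEdge.comm rfl rfl

theorem mass_nonneg {V : Finset (Finset ℕ)} (hV : ∀ v ∈ V, IsPrimeSet v) : 0 ≤ mass V :=
  sum_nonneg fun v hv => (hV v hv).density_pos.le

theorem edgeMass_nonneg (t D K : ℝ) {V W : Finset (Finset ℕ)} (hV : ∀ v ∈ V, IsPrimeSet v)
    (hW : ∀ w ∈ W, IsPrimeSet w) : 0 ≤ edgeMass t D K V W := by
  refine sum_nonneg fun v hv => sum_nonneg fun w hw => ?_
  split_ifs
  · exact mul_nonneg (hV v hv).density_pos.le (hW w hw).density_pos.le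
  · rfl

theorem edgeMass_le_mass_mul_mass (t D K : ℝ) {V W : Finset (Finset ℕ)}
    (hV : ∀ v ∈ V, IsPrimeSet v) (hW : ∀ w ∈ W, IsPrimeSet w) :
    edgeMass t D K V W ≤ mass V * mass W := by
  rw [edgeMass, mass, mass, sum_mul_sum]
  refine sum_le_sum fun v hv => sum_le_sum fun w hw => ?_
  split_ifs
  · rfl
  · exact mul_nonneg (hV v hv).density_pos.le (hW w hw).density_pos.le

/-- If `v` and `w` both differ from `T` in few common primes, then their greatest common divisor
is essentially the product of `T` divided by the primes of `T` missing from `v` or `w`. -/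
theorem setProd_inter_mul_le {T v w : Finset ℕ} (hT : IsPrimeSet T) (hv : IsPrimeSet v) {P : ℝ}
    (hP : setProd (symmDiff v T ∩ symmDiff w T) ≤ P) :
    setProd (v ∩ w) * (setProd (T \ v) * setProd (T \ w)) ≤ setProd T * P ^ 2 := by
  set A := symmDiff v T ∩ symmDiff w T with hA
  have hvT : IsPrimeSet (v ∪ T) := fun p hp => (mem_union.1 hp).elim (hv p) (hT p)
  have hAp : IsPrimeSet A := hvT.mono fun x hx => by
    simp only [hA, mem_inter, mem_symmDiff, mem_union] at hx ⊢; tauto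
  have hsub_le : ∀ {a b : Finset ℕ}, IsPrimeSet b → a ⊆ b → setProd a ≤ setProd b := by
    intro a b hb hab
    rw [setProd, setProd, ← prod_sdiff hab]
    exact le_mul_of_one_le_left (hb.mono hab).setProd_pos.le (hb.mono sdiff_subset).one_le_setProd
  have h1 : setProd (T \ v ∪ T \ w) * setProd ((T \ v) ∩ (T \ w)) =
      setProd (T \ v) * setProd (T \ w) := prod_union_inter
  -- Primes of T missing from both sets lie in A, as do common primes of v and w outside T. Each of
  -- these two discrepancies costs one factor P.
  have h2 : setProd ((T \ v) ∩ (T \ w)) ≤ P := (hsub_le hAp fun x hx => by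
    simp only [hA, mem_inter, mem_symmDiff, mem_sdiff] at hx ⊢; tauto).trans hP
  have h3 : setProd (T \ (T \ v ∪ T \ w)) * setProd (T \ v ∪ T \ w) = setProd T :=
    prod_sdiff (union_subset sdiff_subset sdiff_subset)
  have h4 : setProd (v ∩ w) ≤ setProd (T \ (T \ v ∪ T \ w)) * P := by
    have hs : v ∩ w ⊆ T \ (T \ v ∪ T \ w) ∪ A := fun x hx => by
      simp only [hA, mem_inter, mem_symmDiff, mem_sdiff, mem_union] at hx ⊢; tauto
    have hq : setProd (T \ (T \ v ∪ T \ w) ∪ A) * setProd (T \ (T \ v ∪ T \ w) ∩ A) =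
      setProd (T \ (T \ v ∪ T \ w)) * setProd A := prod_union_inter
    have hq1 : 1 ≤ setProd (T \ (T \ v ∪ T \ w) ∩ A) :=
      (hAp.mono inter_subset_right).one_le_setProd
    have hTp := (hT.mono (sdiff_subset (t := T \ v ∪ T \ w))).setProd_pos
    have hun : IsPrimeSet (T \ (T \ v ∪ T \ w) ∪ A) := fun p hp =>
      (mem_union.1 hp).elim (fun h => hT p (sdiff_subset h)) (hAp p)
    calc setProd (v ∩ w) ≤ setProd (T \ (T \ v ∪ T \ w) ∪ A) := hsub_le hun hs
      _ ≤ setProd (T \ (T \ v ∪ T \ w) ∪ A) * setProd (T \ (T \ v ∪ T \ w) ∩ A) :=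
        le_mul_of_one_le_right hun.setProd_pos.le hq1
      _ ≤ _ := by
        rw [hq]; gcongr
  have hp1 := (hT.mono (union_subset (sdiff_subset (t := v)) (sdiff_subset (t := w)))).setProd_pos
  have hp2 := (hT.mono (inter_subset_left.trans (sdiff_subset (t := v)) :
    (T \ v) ∩ (T \ w) ⊆ T)).setProd_pos
  have hp3 := (hT.mono (sdiff_subset (t := T \ v ∪ T \ w))).setProd_pos
  have hP0 : 0 ≤ P := hp2.le.trans h2
  rw [← h1, ← h3]
  calc _ ≤ setProd (T \ (T \ v ∪ T \ w)) * P * (setProd (T \ v ∪ T \ w) * P) := by gcongr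
    _ = _ := by ring

/-- Once v and w deviate from T at almost disjoint primes, both edge conditions decouple into one
condition on v and one on w, so the indicator of an edge is dominated by a product c f(v) f(w). -/
theorem structured_edgeMass_le {t : ℝ} (ht : 1 ≤ t) {T : Finset ℕ} (hT : IsPrimeSet T)
    {V W : Finset (Finset ℕ)} (hV : ∀ v ∈ V, IsPrimeSet v) (hW : ∀ w ∈ W, IsPrimeSet w)
    {X Y D P : ℝ} (K : ℝ) (hX : 0 ≤ X) (hY : 0 ≤ Y) (hD : 0 < D) (hVX : ∀ v ∈ V, setProd v ≤ X)
    (hWY : ∀ w ∈ W, setProd w ≤ Y) :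
    (∑ v ∈ V, ∑ w ∈ W,
      if IsEdge t D K v w ∧ setProd (symmDiff v T ∩ symmDiff w T) ≤ P then
        density v * density w else 0) ≤
      Real.exp 16 * P ^ 4 * (X * Y / D ^ 2 * Real.exp (-(t * K))) := by
  have hT0 := hT.setProd_pos
  set f : Finset ℕ → ℝ := fun v =>
    density v * rankinWeight t (symmDiff v T) / setProd (T \ v) ^ 2 with hf
  have hfnn : ∀ v, IsPrimeSet v → 0 ≤ f v := fun v hv => by
    have := hv.density_pos
    have := rankinWeight_pos t (symmDiff v T)
    have := (hT.mono (sdiff_subset (t := v))).setProd_pos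
    simp only [hf]; positivity
  set c := Real.exp (-(t * K)) * setProd T ^ 2 * P ^ 4 / D ^ 2 with hc
  have hc0 : 0 ≤ c := by positivity
  have hpt : ∀ v ∈ V, ∀ w ∈ W,
      (if IsEdge t D K v w ∧ setProd (symmDiff v T ∩ symmDiff w T) ≤ P then
        density v * density w else 0) ≤ c * (f v * f w) := by
    intro v hv w hw
    have hv' := hV v hv
    have hw' := hW w hw
    split_ifs with h
    · obtain ⟨⟨h1, h2⟩, h3⟩ := h
      have hv0 := hv'.density_pos
      have hw0 := hw'.density_pos
      have hvm := (hT.mono (sdiff_subset (t := v))).setProd_pos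
      have hwm := (hT.mono (sdiff_subset (t := w))).setProd_pos
      -- The gcd condition gives a quotient that is at least 1; its square supplies the weights ∏(T
      -- \ v)⁻² in f. The reciprocal-sum condition is separated by the triangle inequality for
      -- symmetric differences through T.
      have hA : D * (setProd (T \ v) * setProd (T \ w)) ≤ setProd T * P ^ 2 :=
        le_trans (by gcongr) (setProd_inter_mul_le hT hv' h3)
      have hB : 1 ≤ Real.exp (-(t * K)) *
          (rankinWeight t (symmDiff v T) * rankinWeight t (symmDiff w T)) := by
        rw [rankinWeight_eq, rankinWeight_eq, ← Real.exp_add, ← Real.exp_add]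
        apply Real.one_le_exp
        have h4 : recipSum t (symmDiff v w) ≤
            recipSum t (symmDiff v T) + recipSum t (symmDiff w T) :=
          (recipSum_mono t fun x hx => by
            simp only [mem_symmDiff, mem_union] at hx ⊢; tauto).trans (recipSum_union_le t _ _)
        have h5 := mul_le_mul_of_nonneg_left (h2.trans h4) (zero_le_one.trans ht)
        linarith
      have hC : 1 ≤ (setProd T * P ^ 2 / (D * (setProd (T \ v) * setProd (T \ w)))) ^ 2 := by
        apply one_le_pow₀
        rw [one_le_div (by positivity)]
        exact hA
      calc density v * density w = density v * density w * (1 * 1) := by ring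
        _ ≤ density v * density w * ((Real.exp (-(t * K)) *
          (rankinWeight t (symmDiff v T) * rankinWeight t (symmDiff w T))) *
            (setProd T * P ^ 2 / (D * (setProd (T \ v) * setProd (T \ w)))) ^ 2) := by gcongr
        _ = c * (f v * f w) := by
          simp only [hc, hf]
          field_simp
    · exact mul_nonneg hc0 (mul_nonneg (hfnn v hv') (hfnn w hw'))
  calc _ ≤ ∑ v ∈ V, ∑ w ∈ W, c * (f v * f w) :=
        sum_le_sum fun v hv => sum_le_sum fun w hw => hpt v hv w hw
    _ = c * ((∑ v ∈ V, f v) * ∑ w ∈ W, f w) := by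
        rw [sum_mul_sum, mul_sum]
        exact sum_congr rfl fun v _ => (mul_sum _ _ _).symm
    _ ≤ c * ((Real.exp 8 * X / setProd T) * (Real.exp 8 * Y / setProd T)) := by
        gcongr
        · exact sum_nonneg fun w hw => hfnn w (hW w hw)
        · exact sum_density_mul_rankinWeight_symmDiff_le ht hT hV hX hVX
        · exact sum_density_mul_rankinWeight_symmDiff_le ht hT hW hY hWY
    _ = _ := by
        rw [hc, show (16 : ℝ) = 8 + 8 by norm_num, Real.exp_add]
        field_simp

/-! ### Splitting with respect to a prime -/

/-- Members of `V` not containing `p`. -/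
def without (p : ℕ) (V : Finset (Finset ℕ)) : Finset (Finset ℕ) := V.filter (p ∉ ·)

/-- Members of `V` containing `p`. -/
def containing (p : ℕ) (V : Finset (Finset ℕ)) : Finset (Finset ℕ) := V.filter (p ∈ ·)

/-- Members of `V` containing `p`, with `p` removed. -/
def link (p : ℕ) (V : Finset (Finset ℕ)) : Finset (Finset ℕ) :=
  (containing p V).image (·.erase p)

theorem sum_link (p : ℕ) (V : Finset (Finset ℕ)) (f : Finset ℕ → ℝ) :
    ∑ v ∈ link p V, f v = ∑ v ∈ containing p V, f (v.erase p) := by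
  refine sum_image fun v hv w hw h => ?_
  rw [mem_coe, containing, mem_filter] at hv hw
  rw [← insert_erase hv.2, ← insert_erase hw.2]
  exact congrArg (insert p) h

theorem sum_containing_add_sum_without (p : ℕ) (V : Finset (Finset ℕ)) (f : Finset ℕ → ℝ) :
    ∑ v ∈ containing p V, f v + ∑ v ∈ without p V, f v = ∑ v ∈ V, f v :=
  sum_filter_add_sum_filter_not V (p ∈ ·) f

theorem density_eq_mul_erase {p : ℕ} {v : Finset ℕ} (h : p ∈ v) :
    density v = (1 - 1 / (p : ℝ)) * density (v.erase p) :=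
  (mul_prod_erase v (fun p : ℕ => 1 - 1 / (p : ℝ)) h).symm

theorem setProd_eq_mul_erase {p : ℕ} {v : Finset ℕ} (h : p ∈ v) :
    setProd v = p * setProd (v.erase p) :=
  (mul_prod_erase v (fun p : ℕ => (p : ℝ)) h).symm

theorem mass_containing (p : ℕ) (V : Finset (Finset ℕ)) :
    mass (containing p V) = (1 - 1 / (p : ℝ)) * mass (link p V) := by
  rw [mass, mass, sum_link, mul_sum]
  exact sum_congr rfl fun v hv => density_eq_mul_erase (mem_filter.1 hv).2

theorem isEdge_erase_erase {t D K : ℝ} {p : ℕ} (hp : 0 < p) {v w : Finset ℕ} (hv : p ∈ v)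
    (hw : p ∈ w) : IsEdge t D K v w ↔ IsEdge t (D / p) K (v.erase p) (w.erase p) := by
  have hp' : (0 : ℝ) < p := by exact_mod_cast hp
  have h1 : (v ∩ w).erase p = v.erase p ∩ w.erase p := by
    ext x; simp only [mem_erase, mem_inter]; tauto
  have h2 : symmDiff (v.erase p) (w.erase p) = symmDiff v w := by
    ext x
    simp only [mem_erase, mem_symmDiff]
    by_cases hx : x = p
    · subst hx; tauto
    · tauto
  rw [IsEdge, IsEdge, h2, setProd_eq_mul_erase (mem_inter.2 ⟨hv, hw⟩), h1, div_le_iff₀' hp']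

theorem isEdge_erase_left {t D K : ℝ} {p : ℕ} {v w : Finset ℕ} (hv : p ∈ v) (hw : p ∉ w) :
    IsEdge t D K v w ↔
      IsEdge t D (K - if t < p then 1 / (p : ℝ) else 0) (v.erase p) w := by
  have h1 : v.erase p ∩ w = v ∩ w := by
    ext x
    simp only [mem_erase, mem_inter]
    by_cases hx : x = p
    · subst hx; tauto
    · tauto
  have h2 : symmDiff v w = insert p (symmDiff (v.erase p) w) := by
    ext x
    simp only [mem_erase, mem_symmDiff, mem_insert]
    by_cases hx : x = p
    · subst hx; tauto
    · tauto
  have h3 : p ∉ symmDiff (v.erase p) w := by simp [mem_symmDiff, hw]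
  rw [IsEdge, IsEdge, h1, h2, recipSum_insert t h3, sub_le_iff_le_add']

theorem edgeMass_containing_containing (t D K : ℝ) {p : ℕ} (hp : 0 < p)
    (V W : Finset (Finset ℕ)) :
    edgeMass t D K (containing p V) (containing p W) =
      (1 - 1 / (p : ℝ)) ^ 2 * edgeMass t (D / p) K (link p V) (link p W) := by
  rw [edgeMass, edgeMass, sum_link, mul_sum]
  refine sum_congr rfl fun v hv => ?_
  rw [sum_link, mul_sum]
  refine sum_congr rfl fun w hw => ?_
  have hv := (mem_filter.1 hv).2
  have hw := (mem_filter.1 hw).2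
  rw [density_eq_mul_erase hv, density_eq_mul_erase hw, mul_ite, mul_zero]
  exact if_congr (isEdge_erase_erase hp hv hw) (by ring) rfl

theorem edgeMass_containing_without (t D K : ℝ) (p : ℕ) (V W : Finset (Finset ℕ)) :
    edgeMass t D K (containing p V) (without p W) =
      (1 - 1 / (p : ℝ)) *
        edgeMass t D (K - if t < p then 1 / (p : ℝ) else 0) (link p V) (without p W) := by
  rw [edgeMass, edgeMass, sum_link, mul_sum]
  refine sum_congr rfl fun v hv => ?_
  rw [mul_sum]
  refine sum_congr rfl fun w hw => ?_
  have hv := (mem_filter.1 hv).2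
  have hw := (mem_filter.1 hw).2
  rw [density_eq_mul_erase hv, mul_ite, mul_zero]
  exact if_congr (isEdge_erase_left hv hw) (by ring) rfl

theorem edgeMass_split (t D K : ℝ) (p : ℕ) (V W : Finset (Finset ℕ)) :
    edgeMass t D K V W =
      edgeMass t D K (containing p V) (containing p W) +
      edgeMass t D K (containing p V) (without p W) +
      (edgeMass t D K (without p V) (containing p W) +
      edgeMass t D K (without p V) (without p W)) := by
  simp only [edgeMass]
  rw [← sum_containing_add_sum_without p V, ← sum_add_distrib, ← sum_add_distrib]
  congr 1 <;>
  exact sum_congr rfl fun v _ => (sum_containing_add_sum_without p W _).symm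

/-- A size of families, decreasing under all pieces of a splitting. -/
def famSize (V : Finset (Finset ℕ)) : ℕ := ∑ v ∈ V, (v.card + 1)

theorem famSize_split (p : ℕ) (V : Finset (Finset ℕ)) :
    famSize V = famSize (link p V) + (containing p V).card + famSize (without p V) := by
  have h1 : famSize (link p V) + (containing p V).card = famSize (containing p V) := by
    have : famSize (link p V) = ∑ v ∈ containing p V, v.card := by
      rw [famSize, link, sum_image]
      · refine sum_congr rfl fun v hv => ?_
        rw [card_erase_add_one (mem_filter.1 hv).2]
      · intro v hv w hw h
        rw [mem_coe, containing, mem_filter] at hv hw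
        rw [← insert_erase hv.2, ← insert_erase hw.2]
        exact congrArg (insert p) h
    rw [this, famSize, sum_add_distrib, sum_const, smul_eq_mul, mul_one]
  rw [h1]
  exact (sum_filter_add_sum_filter_not V (p ∈ ·) _).symm

theorem isPrimeSet_of_mem_link {p : ℕ} {V : Finset (Finset ℕ)} (hV : ∀ v ∈ V, IsPrimeSet v) :
    ∀ v ∈ link p V, IsPrimeSet v := by
  intro v hv
  obtain ⟨u, hu, rfl⟩ := mem_image.1 hv
  exact (hV u (mem_filter.1 hu).1).mono (erase_subset _ _)

theorem isPrimeSet_of_mem_without {p : ℕ} {V : Finset (Finset ℕ)}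
    (hV : ∀ v ∈ V, IsPrimeSet v) : ∀ v ∈ without p V, IsPrimeSet v :=
  fun v hv => hV v (mem_filter.1 hv).1

theorem isPrimeSet_of_mem_containing {p : ℕ} {V : Finset (Finset ℕ)}
    (hV : ∀ v ∈ V, IsPrimeSet v) : ∀ v ∈ containing p V, IsPrimeSet v :=
  fun v hv => hV v (mem_filter.1 hv).1

theorem setProd_le_of_mem_link {p : ℕ} (hp : 0 < p) {V : Finset (Finset ℕ)} {X : ℝ}
    (hV : ∀ v ∈ V, setProd v ≤ X) : ∀ v ∈ link p V, setProd v ≤ X / p := by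
  intro v hv
  obtain ⟨u, hu, rfl⟩ := mem_image.1 hv
  have hp' : (0 : ℝ) < p := by exact_mod_cast hp
  rw [le_div_iff₀' hp', ← setProd_eq_mul_erase (mem_filter.1 hu).2]
  exact hV u (mem_filter.1 hu).1

/-! ### The bilinear inequality -/

/-- The scale-invariant quantity controlling `edgeMass t D K`. -/
noncomputable def scale (t X Y D K : ℝ) : ℝ := X * Y / D ^ 2 * Real.exp (-(t * K))

theorem scale_pos {t X Y D : ℝ} (K : ℝ) (hX : 0 < X) (hY : 0 < Y) (hD : 0 < D) :
    0 < scale t X Y D K := by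
  unfold scale; positivity

/-- The bilinear inequality for the pair of families `(V, W)`. -/
def BilinearBound (C t : ℝ) (V W : Finset (Finset ℕ)) : Prop :=
  ∀ X Y D K : ℝ, 0 < X → 0 < Y → 0 < D → (∀ v ∈ V, setProd v ≤ X) → (∀ w ∈ W, setProd w ≤ Y) →
    edgeMass t D K V W ≤
      C * (fourthRoot (mass V) * fourthRoot (mass W)) ^ 3 * fourthRoot (scale t X Y D K)

theorem BilinearBound.symm {C t : ℝ} {V W : Finset (Finset ℕ)} (h : BilinearBound C t V W) :
    BilinearBound C t W V := by
  intro X Y D K hX hY hD hV hW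
  rw [edgeMass_comm, mul_comm (fourthRoot _) (fourthRoot _), scale, mul_comm X]
  exact h Y X D K hY hX hD hW hV

theorem scale_div_div {t X Y D K : ℝ} {p : ℕ} (hp : 0 < p) :
    scale t (X / p) (Y / p) (D / p) K = scale t X Y D K := by
  have hp' : (0 : ℝ) < p := by exact_mod_cast hp
  unfold scale
  congr 1
  field_simp

/-- Deleting p from one side only leaves the gcd alone, so X gains a factor 1/p uncompensated by D.
Lowering K by 1/p, which happens only for p > t, costs e^(t/p) ≤ e ≤ 3. -/
theorem scale_div_le {t X Y D : ℝ} (K : ℝ) (hX : 0 < X) (hY : 0 < Y) (hD : 0 < D) (p : ℕ) :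
    scale t (X / p) Y D (K - if t < p then 1 / (p : ℝ) else 0) ≤ 3 / p * scale t X Y D K := by
  have h1 : t * (if t < p then 1 / (p : ℝ) else 0) ≤ 1 := by
    split_ifs with h
    · rcases (Nat.cast_nonneg (α := ℝ) p).eq_or_lt with h0 | h0
      · simp [← h0]
      · rw [mul_one_div, div_le_one h0]; exact h.le
    · simp
  have h2 : Real.exp (-(t * (K - if t < p then 1 / (p : ℝ) else 0))) ≤
      Real.exp (-(t * K)) * 3 := by
    calc _ = Real.exp (-(t * K)) * Real.exp (t * if t < p then 1 / (p : ℝ) else 0) := by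
          rw [← Real.exp_add]; congr 1; ring
      _ ≤ Real.exp (-(t * K)) * Real.exp 1 := by gcongr
      _ ≤ _ := by
          gcongr
          linarith [Real.exp_one_lt_d9]
  unfold scale
  calc _ ≤ X / p * Y / D ^ 2 * (Real.exp (-(t * K)) * 3) := by gcongr
    _ = _ := by ring

/-- Removing p from both sides keeps the scale. The factor κ = 1 - 1/p enters squared on the left
but only to the power 3/2 on the right, so it is harmless. -/
theorem edgeMass_containing_containing_le {C t : ℝ} {p : ℕ} (hp : p.Prime)
    {V W : Finset (Finset ℕ)} (h : BilinearBound C t (link p V) (link p W))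
    (hV : ∀ v ∈ V, IsPrimeSet v) (hW : ∀ w ∈ W, IsPrimeSet w)
    {X Y D K : ℝ} (hX : 0 < X) (hY : 0 < Y) (hD : 0 < D)
    (hVX : ∀ v ∈ V, setProd v ≤ X) (hWY : ∀ w ∈ W, setProd w ≤ Y) :
    edgeMass t D K (containing p V) (containing p W) ≤
      C * (fourthRoot (mass (containing p V)) * fourthRoot (mass (containing p W))) ^ 3 *
        fourthRoot (scale t X Y D K) := by
  have hp0 : (0 : ℝ) < p := by exact_mod_cast hp.pos
  have h1 := h (X / p) (Y / p) (D / p) K (by positivity) (by positivity) (by positivity)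
    (setProd_le_of_mem_link hp.pos hVX) (setProd_le_of_mem_link hp.pos hWY)
  rw [scale_div_div hp.pos] at h1
  have hκ0 := (one_sub_inv_prime_pos hp).le
  have hκ1 := one_sub_inv_prime_le_one p
  rw [edgeMass_containing_containing _ _ _ hp.pos, mass_containing, mass_containing,
    fourthRoot_mul hκ0, fourthRoot_mul hκ0]
  set κ := 1 - 1 / (p : ℝ)
  set k := fourthRoot κ with hk
  have hk0 : 0 ≤ k := fourthRoot_nonneg _
  have hk4 : k ^ 4 = κ := fourthRoot_pow hκ0
  have hk1 : k ≤ 1 := by rw [← fourthRoot_one]; exact fourthRoot_mono hκ1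
  have hκ6 : κ ^ 2 ≤ k ^ 6 := by
    rw [← hk4, ← pow_mul]
    exact pow_le_pow_of_le_one hk0 hk1 (by norm_num)
  have hnn := edgeMass_nonneg t (D / p) K (isPrimeSet_of_mem_link (p := p) hV)
    (isPrimeSet_of_mem_link (p := p) hW)
  calc _ ≤ k ^ 6 * edgeMass t (D / p) K (link p V) (link p W) := by gcongr
    _ ≤ k ^ 6 * (C * (fourthRoot (mass (link p V)) * fourthRoot (mass (link p W))) ^ 3 *
        fourthRoot (scale t X Y D K)) := by gcongr
    _ = _ := by ring

/-- Here the scale drops, and its fourth root yields the gain (3/p)^(1/4) that penalises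
off-diagonal pieces. -/
theorem edgeMass_containing_without_le {C t : ℝ} (hC : 0 ≤ C) {p : ℕ} (hp : p.Prime)
    {V W : Finset (Finset ℕ)} (h : BilinearBound C t (link p V) (without p W))
    (hV : ∀ v ∈ V, IsPrimeSet v) (hW : ∀ w ∈ W, IsPrimeSet w)
    {X Y D K : ℝ} (hX : 0 < X) (hY : 0 < Y) (hD : 0 < D)
    (hVX : ∀ v ∈ V, setProd v ≤ X) (hWY : ∀ w ∈ W, setProd w ≤ Y) :
    edgeMass t D K (containing p V) (without p W) ≤
      C * (fourthRoot (mass (containing p V)) * fourthRoot (mass (without p W))) ^ 3 *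
        (fourthRoot (3 / p) * fourthRoot (scale t X Y D K)) := by
  have hp0 : (0 : ℝ) < p := by exact_mod_cast hp.pos
  have h1 := h (X / p) Y D (K - if t < p then 1 / (p : ℝ) else 0) (by positivity) hY hD
    (setProd_le_of_mem_link hp.pos hVX) (fun w hw => hWY w (mem_filter.1 hw).1)
  have h2 := fourthRoot_mono (scale_div_le (t := t) K hX hY hD p)
  rw [fourthRoot_mul (by positivity)] at h2
  have hκ0 := (one_sub_inv_prime_pos hp).le
  have hκ1 := one_sub_inv_prime_le_one p
  rw [edgeMass_containing_without, mass_containing, fourthRoot_mul hκ0]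
  set κ := 1 - 1 / (p : ℝ)
  set k := fourthRoot κ with hk
  have hk0 : 0 ≤ k := fourthRoot_nonneg _
  have hk4 : k ^ 4 = κ := fourthRoot_pow hκ0
  have hk1 : k ≤ 1 := by rw [← fourthRoot_one]; exact fourthRoot_mono hκ1
  have hκ3 : κ ≤ k ^ 3 := by
    rw [← hk4]
    exact pow_le_pow_of_le_one hk0 hk1 (by norm_num)
  have hnn := edgeMass_nonneg t D (K - if t < p then 1 / (p : ℝ) else 0)
    (isPrimeSet_of_mem_link (p := p) hV) (isPrimeSet_of_mem_without (p := p) hW)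
  have ha := fourthRoot_nonneg (mass (link p V))
  have hb := fourthRoot_nonneg (mass (without p W))
  calc _ ≤ k ^ 3 * edgeMass t D (K - if t < p then 1 / (p : ℝ) else 0) (link p V)
        (without p W) := by gcongr
    _ ≤ k ^ 3 * (C * (fourthRoot (mass (link p V)) * fourthRoot (mass (without p W))) ^ 3 *
        (fourthRoot (3 / p) * fourthRoot (scale t X Y D K))) := by
        gcongr
        exact h1.trans (by gcongr)
    _ = _ := by ring

/-- For a pair violating the bilinear inequality, every large prime has a preferred type: few edges
avoid `p` on both sides, or few edges contain `p` on both sides. -/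
theorem prime_type {C t : ℝ} (hC : 0 < C) {V W : Finset (Finset ℕ)}
    (IH : ∀ V' W' : Finset (Finset ℕ), famSize V' + famSize W' < famSize V + famSize W →
      (∀ v ∈ V', IsPrimeSet v) → (∀ w ∈ W', IsPrimeSet w) → BilinearBound C t V' W')
    (hV : ∀ v ∈ V, IsPrimeSet v) (hW : ∀ w ∈ W, IsPrimeSet w)
    (hmV : 0 < mass V) (hmW : 0 < mass W)
    {X Y D K : ℝ} (hX : 0 < X) (hY : 0 < Y) (hD : 0 < D)
    (hVX : ∀ v ∈ V, setProd v ≤ X) (hWY : ∀ w ∈ W, setProd w ≤ Y)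
    {B : ℝ} (hB : B = C * (fourthRoot (mass V) * fourthRoot (mass W)) ^ 3 *
      fourthRoot (scale t X Y D K)) (hfail : B ≤ edgeMass t D K V W)
    {p : ℕ} (hp : p.Prime) (hpbig : fourthRoot (3 / p) ≤ 1 / 25)
    (hmem : p ∈ V.sup id ∪ W.sup id) :
    edgeMass t D K (without p V) (without p W) ≤ B * (205 ^ 3 * fourthRoot (3 / p) ^ 6) ∨
    edgeMass t D K (containing p V) (containing p W) ≤
      B * (205 ^ 3 * fourthRoot (3 / p) ^ 6) := by
  have hsV := famSize_split p V
  have hsW := famSize_split p W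
  have hpos : 0 < (containing p V).card + (containing p W).card := by
    rw [mem_union, mem_sup, mem_sup] at hmem
    rcases hmem with ⟨v, hv, hpv⟩ | ⟨v, hv, hpv⟩
    · have : 0 < (containing p V).card := card_pos.2 ⟨v, mem_filter.2 ⟨hv, hpv⟩⟩
      omega
    · have : 0 < (containing p W).card := card_pos.2 ⟨v, mem_filter.2 ⟨hv, hpv⟩⟩
      omega
  -- Since p occurs in some member, `hpos` makes all four pieces strictly smaller than (V, W), so
  -- the induction hypothesis applies to each.
  have hM := scale_pos (t := t) K hX hY hD
  set m := fourthRoot (scale t X Y D K) with hm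
  have hm0 : 0 < m := fourthRoot_pos hM
  set ε := fourthRoot (3 / (p : ℝ)) with hε
  have hε0 : 0 ≤ ε := fourthRoot_nonneg _
  have hpp := edgeMass_containing_containing_le (K := K) hp
    (IH (link p V) (link p W) (by omega)
      (isPrimeSet_of_mem_link hV) (isPrimeSet_of_mem_link hW)) hV hW hX hY hD hVX hWY
  have hpn := edgeMass_containing_without_le (K := K) hC.le hp
    (IH (link p V) (without p W) (by omega)
      (isPrimeSet_of_mem_link hV) (isPrimeSet_of_mem_without hW)) hV hW hX hY hD hVX hWY
  have hnp := edgeMass_containing_without_le (K := K) hC.le hp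
    (IH (link p W) (without p V) (by omega)
      (isPrimeSet_of_mem_link hW) (isPrimeSet_of_mem_without hV)) hW hV hY hX hD hWY hVX
  have hnn := IH (without p V) (without p W) (by omega)
      (isPrimeSet_of_mem_without hV) (isPrimeSet_of_mem_without hW) X Y D K hX hY hD
      (fun v hv => hVX v (mem_filter.1 hv).1) (fun w hw => hWY w (mem_filter.1 hw).1)
  rw [edgeMass_comm, scale, mul_comm Y, ← scale] at hnp
  rw [edgeMass_split t D K p] at hfail
  have hVs : mass (containing p V) + mass (without p V) = mass V :=
    sum_containing_add_sum_without p V _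
  have hWs : mass (containing p W) + mass (without p W) = mass W :=
    sum_containing_add_sum_without p W _
  have e1 := fourthRoot_pow (mass_nonneg (isPrimeSet_of_mem_containing (p := p) hV))
  have e2 := fourthRoot_pow (mass_nonneg (isPrimeSet_of_mem_without (p := p) hV))
  have e3 := fourthRoot_pow (mass_nonneg (isPrimeSet_of_mem_containing (p := p) hW))
  have e4 := fourthRoot_pow (mass_nonneg (isPrimeSet_of_mem_without (p := p) hW))
  have e5 := fourthRoot_pow hmV.le
  have e6 := fourthRoot_pow hmW.le
  have hr0 := fourthRoot_pos hmV
  have hs0 := fourthRoot_pos hmW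
  have hx1 := fourthRoot_nonneg (mass (containing p V))
  have hx0 := fourthRoot_nonneg (mass (without p V))
  have hy1 := fourthRoot_nonneg (mass (containing p W))
  have hy0 := fourthRoot_nonneg (mass (without p W))
  rw [← e1, ← e2, ← e5] at hVs
  rw [← e3, ← e4, ← e6] at hWs
  generalize fourthRoot (mass (containing p V)) = x₁ at *
  generalize fourthRoot (mass (without p V)) = x₀ at *
  generalize fourthRoot (mass (containing p W)) = y₁ at *
  generalize fourthRoot (mass (without p W)) = y₀ at *
  generalize fourthRoot (mass V) = r at *
  generalize fourthRoot (mass W) = s at *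
  rw [← hm] at hpp hpn hnp hnn
  have hrs : 0 < r * s := by positivity
  -- The four quotients are the fourth roots of a product of two probability measures on two points;
  -- the product structure is the relation ab = cd.
  have hsum : (x₀ * y₀ / (r * s)) ^ 4 + (x₁ * y₁ / (r * s)) ^ 4 + (x₁ * y₀ / (r * s)) ^ 4 +
      (x₀ * y₁ / (r * s)) ^ 4 = 1 := by
    have : (r * s) ^ 4 = (x₁ ^ 4 + x₀ ^ 4) * (y₁ ^ 4 + y₀ ^ 4) := by rw [hVs, hWs, mul_pow]
    simp only [div_pow]
    rw [← add_div, ← add_div, ← add_div, div_eq_one_iff_eq (by positivity), this]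
    ring
  have hmul : x₀ * y₀ / (r * s) * (x₁ * y₁ / (r * s)) =
      x₁ * y₀ / (r * s) * (x₀ * y₁ / (r * s)) := by ring
  have hone : 1 ≤ (x₀ * y₀ / (r * s)) ^ 3 + (x₁ * y₁ / (r * s)) ^ 3 +
      ε * ((x₁ * y₀ / (r * s)) ^ 3 + (x₀ * y₁ / (r * s)) ^ 3) := by
    have h1 : C * m * (r * s) ^ 3 ≤ C * m * ((x₀ * y₀) ^ 3 + (x₁ * y₁) ^ 3 +
        ε * ((x₁ * y₀) ^ 3 + (x₀ * y₁) ^ 3)) := by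
      rw [hB] at hfail
      linarith
    have h2 := le_of_mul_le_mul_left h1 (by positivity)
    simp only [div_pow]
    rw [← add_div, ← add_div, ← mul_div_assoc, ← add_div, one_le_div (by positivity)]
    exact h2
  -- The bilinear bound involves the cube of z, so a share of 205ε² becomes 205³ε⁶, of order
  -- p^(-3/2).
  have hfin : ∀ z E : ℝ, 0 ≤ z / (r * s) → z / (r * s) ≤ 205 * ε ^ 2 → E ≤ C * z ^ 3 * m →
      E ≤ B * (205 ^ 3 * ε ^ 6) := by
    intro z E hz0 hz hE
    have h3 : (z / (r * s)) ^ 3 ≤ (205 * ε ^ 2) ^ 3 := by gcongr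
    calc E ≤ C * z ^ 3 * m := hE
      _ = C * (r * s) ^ 3 * m * (z / (r * s)) ^ 3 := by field_simp
      _ ≤ C * (r * s) ^ 3 * m * (205 * ε ^ 2) ^ 3 := by gcongr
      _ = _ := by rw [hB]; ring
  rcases le_total (x₁ * y₁ / (r * s)) (x₀ * y₀ / (r * s)) with hle | hle
  · right
    exact hfin _ _ (by positivity) (two_point_le (by positivity) (by positivity) hε0 hpbig hle
      hsum hmul hone) hpp
  · left
    exact hfin _ _ (by positivity) (two_point_le (c := x₁ * y₀ / (r * s)) (d := x₀ * y₁ / (r * s))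
      (by positivity) (by positivity) hε0 hpbig hle
      (by linarith) (by rw [mul_comm, hmul]) (by linarith)) hnn

/-! ### Summing the rare pieces over primes, and the induction -/

theorem fourthRoot_pow_six {x : ℝ} (hx : 0 ≤ x) : fourthRoot x ^ 6 = x ^ (3 / 2 : ℝ) := by
  have h : fourthRoot x = x ^ (1 / 4 : ℝ) := by
    rw [fourthRoot, Real.sqrt_eq_rpow, Real.sqrt_eq_rpow, ← Real.rpow_mul hx]; norm_num
  rw [h, ← Real.rpow_natCast, ← Real.rpow_mul hx]; norm_num

theorem summable_fourthRoot_pow_six :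
    Summable fun p : ℕ => 205 ^ 3 * fourthRoot (3 / (p : ℝ)) ^ 6 := by
  refine Summable.mul_left _ ?_
  have : (fun p : ℕ => fourthRoot (3 / (p : ℝ)) ^ 6) =
      fun p : ℕ => (3 : ℝ) ^ (3 / 2 : ℝ) * (1 / (p : ℝ) ^ (3 / 2 : ℝ)) := by
    ext p
    rw [fourthRoot_pow_six (by positivity), Real.div_rpow (by norm_num) (by positivity)]
    ring
  rw [this]
  exact (Real.summable_one_div_nat_rpow.2 (by norm_num)).mul_left _

/-- The series of order p^(-3/2) converges, so its tail is at most 1/2; the extra 3 · 25⁴ in the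
witness makes 3/p ≤ 25⁻⁴. -/
theorem exists_prime_threshold : ∃ p₀ : ℕ, (∀ p, p₀ ≤ p → fourthRoot (3 / (p : ℝ)) ≤ 1 / 25) ∧
    ∀ R : Finset ℕ, (∀ p ∈ R, p₀ ≤ p) →
      ∑ p ∈ R, 205 ^ 3 * fourthRoot (3 / (p : ℝ)) ^ 6 ≤ 1 / 2 := by
  obtain ⟨s, hs⟩ := summable_iff_vanishing_norm.1 summable_fourthRoot_pow_six (1 / 2) (by norm_num)
  obtain ⟨n, hn⟩ := s.exists_nat_subset_range
  refine ⟨n + 3 * 25 ^ 4, fun p hp => ?_, fun R hR => ?_⟩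
  · have h : (3 : ℝ) / p ≤ (1 / 25) ^ 4 := by
      have : ((n + 3 * 25 ^ 4 : ℕ) : ℝ) ≤ p := by exact_mod_cast hp
      push_cast at this
      have hn0 : (0 : ℝ) ≤ n := Nat.cast_nonneg n
      rw [div_le_iff₀ (by linarith)]
      linarith
    exact (fourthRoot_mono h).trans (fourthRoot_pow_four (by norm_num)).le
  · have := hs R (disjoint_left.2 fun p hp hps => by
      have h1 := hR p hp
      have h2 := mem_range.1 (hn hps)
      omega)
    exact (le_abs_self _).trans this.le

theorem edgeMass_filter (t D K : ℝ) (a b : Finset ℕ → Prop) [DecidablePred a] [DecidablePred b]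
    (V W : Finset (Finset ℕ)) :
    edgeMass t D K (V.filter a) (W.filter b) =
      ∑ v ∈ V, ∑ w ∈ W, if IsEdge t D K v w ∧ a v ∧ b w then density v * density w else 0 := by
  rw [edgeMass, sum_filter]
  refine sum_congr rfl fun v _ => ?_
  rw [sum_filter]
  by_cases h : a v
  · rw [if_pos h]
    refine sum_congr rfl fun w _ => ?_
    by_cases h' : b w <;> simp [h, h']
  · simp [h]

/-- In a minimal counterexample all large primes have a preferred type simultaneously on half of the
edges. The structured bound then applies to these, with a constant independent of the induction, so
no loss accumulates. -/
theorem exists_bilinearBound : ∃ C : ℝ, 0 < C ∧ ∀ t : ℝ, 1 ≤ t → ∀ V W : Finset (Finset ℕ),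
    (∀ v ∈ V, IsPrimeSet v) → (∀ w ∈ W, IsPrimeSet w) → BilinearBound C t V W := by
  obtain ⟨p₀, hp₀, hsum⟩ := exists_prime_threshold
  set P := setProd ((range p₀).filter Nat.Prime) with hPdef
  have hPrange : IsPrimeSet ((range p₀).filter Nat.Prime) := fun p hp => (mem_filter.1 hp).2
  have hP0 : 0 < P := hPrange.setProd_pos
  set C₁ := 2 * (Real.exp 16 * P ^ 4) with hC₁
  have hC₁0 : 0 < C₁ := by positivity
  refine ⟨fourthRoot C₁, fourthRoot_pos hC₁0, fun t ht V W => ?_⟩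
  have hC := fourthRoot_pos hC₁0
  induction hn : famSize V + famSize W using Nat.strong_induction_on generalizing V W with
  | _ n IH =>
  intro hV hW X Y D K hX hY hD hVX hWY
  by_contra! hlt
  set B := fourthRoot C₁ * (fourthRoot (mass V) * fourthRoot (mass W)) ^ 3 *
    fourthRoot (scale t X Y D K) with hB
  have hM := scale_pos (t := t) K hX hY hD
  have hr := fourthRoot_nonneg (mass V)
  have hs := fourthRoot_nonneg (mass W)
  have hB0 : 0 ≤ B := by
    have := fourthRoot_pos hM
    positivity
  have hmVW := edgeMass_le_mass_mul_mass t D K hV hW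
  have hprod : 0 < mass V * mass W := hB0.trans_lt (hlt.trans_le hmVW)
  have hmV : 0 < mass V := pos_of_mul_pos_left hprod (mass_nonneg hW)
  have hmW : 0 < mass W := pos_of_mul_pos_right hprod (mass_nonneg hV)
  set big := (V.sup id ∪ W.sup id).filter (p₀ ≤ ·) with hbig
  have hUprime : IsPrimeSet (V.sup id ∪ W.sup id) := by
    intro p hp
    rw [mem_union, mem_sup, mem_sup] at hp
    rcases hp with ⟨v, hv, hpv⟩ | ⟨v, hv, hpv⟩
    exacts [hV v hv p hpv, hW v hv p hpv]
  have htype : ∀ p ∈ big,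
      edgeMass t D K (without p V) (without p W) ≤ B * (205 ^ 3 * fourthRoot (3 / p) ^ 6) ∨
      edgeMass t D K (containing p V) (containing p W) ≤
        B * (205 ^ 3 * fourthRoot (3 / p) ^ 6) := by
    intro p hp
    rw [hbig, mem_filter] at hp
    refine prime_type hC (fun V' W' hlt' hV' hW' => IH _ (hn ▸ hlt') V' W' rfl hV' hW')
      hV hW hmV hmW hX hY hD hVX hWY hB hlt.le (hUprime p hp.1) (hp₀ p hp.2) hp.1
  classical
  -- For p in T the pairs avoiding p on both sides are rare; for the other large primes the pairs
  -- containing p on both sides are rare.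
  set T := big.filter fun p =>
    edgeMass t D K (without p V) (without p W) ≤ B * (205 ^ 3 * fourthRoot (3 / p) ^ 6) with hT
  have hTbig : T ⊆ big := filter_subset _ _
  have hTp : IsPrimeSet T := hUprime.mono (hTbig.trans (filter_subset _ _))
  set bad : ℕ → ℝ := fun p => if p ∈ T then edgeMass t D K (without p V) (without p W)
    else edgeMass t D K (containing p V) (containing p W) with hbad
  have hbadle : ∀ p ∈ big, bad p ≤ B * (205 ^ 3 * fourthRoot (3 / p) ^ 6) := by
    intro p hp
    simp only [hbad]
    split_ifs with h
    · exact (mem_filter.1 h).2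
    · exact (htype p hp).resolve_left fun h' => h (mem_filter.2 ⟨hp, h'⟩)
  have hbadsum : ∑ p ∈ big, bad p ≤ B * (1 / 2) := by
    calc _ ≤ ∑ p ∈ big, B * (205 ^ 3 * fourthRoot (3 / p) ^ 6) := sum_le_sum hbadle
      _ = B * ∑ p ∈ big, 205 ^ 3 * fourthRoot (3 / (p : ℝ)) ^ 6 := by rw [mul_sum]
      _ ≤ _ := by
        gcongr
        exact hsum big fun p hp => (mem_filter.1 hp).2
  have hgood := structured_edgeMass_le ht hTp hV hW (P := P) K hX.le hY.le hD hVX hWY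
  have hbadeq : ∀ p, bad p = ∑ v ∈ V, ∑ w ∈ W,
      if IsEdge t D K v w ∧ (if p ∈ T then p ∉ v ∧ p ∉ w else p ∈ v ∧ p ∈ w) then
        density v * density w else 0 := by
    intro p
    simp only [hbad]
    split_ifs with h
    · exact edgeMass_filter t D K _ _ V W
    · exact edgeMass_filter t D K _ _ V W
  -- An edge that is not structured has a prime p ≥ p₀ at which both v and w disagree with T; it is
  -- then counted in the rare piece of p. Otherwise the common deviations are primes below p₀, whose
  -- product is at most P.
  have hcover : edgeMass t D K V W ≤ (∑ v ∈ V, ∑ w ∈ W,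
      if IsEdge t D K v w ∧ setProd (symmDiff v T ∩ symmDiff w T) ≤ P then
        density v * density w else 0) + ∑ p ∈ big, bad p := by
    simp only [hbadeq]
    rw [sum_comm (s := big), ← sum_add_distrib, edgeMass]
    refine sum_le_sum fun v hv => ?_
    rw [sum_comm (s := big), ← sum_add_distrib]
    refine sum_le_sum fun w hw => ?_
    have hnn : 0 ≤ density v * density w :=
      mul_nonneg (hV v hv).density_pos.le (hW w hw).density_pos.le
    have hnn' : ∀ p ∈ big, 0 ≤ if IsEdge t D K v w ∧
        (if p ∈ T then p ∉ v ∧ p ∉ w else p ∈ v ∧ p ∈ w) then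
        density v * density w else 0 := fun p _ => by split_ifs <;> simp [hnn]
    have hnn2 := sum_nonneg hnn'
    by_cases hE : IsEdge t D K v w
    swap
    · simp [hE]
    by_cases hg : setProd (symmDiff v T ∩ symmDiff w T) ≤ P
    · rw [if_pos hE, if_pos ⟨hE, hg⟩]
      linarith
    · obtain ⟨p, hp, hpp⟩ : ∃ p ∈ symmDiff v T ∩ symmDiff w T, p₀ ≤ p := by
        by_contra! hall
        apply hg
        have hsub : symmDiff v T ∩ symmDiff w T ⊆ (range p₀).filter Nat.Prime := by
          intro p hp
          rw [mem_filter, mem_range]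
          refine ⟨hall p hp, ?_⟩
          rw [mem_inter, mem_symmDiff, mem_symmDiff] at hp
          rcases hp.1 with h | h
          exacts [hV v hv p h.1, hTp p h.1]
        rw [hPdef, setProd, setProd, ← prod_sdiff hsub]
        exact le_mul_of_one_le_left (hPrange.mono hsub).setProd_pos.le
          (hPrange.mono sdiff_subset).one_le_setProd
      rw [mem_inter, mem_symmDiff, mem_symmDiff] at hp
      have hpbig : p ∈ big := by
        by_cases hpT : p ∈ T
        · exact hTbig hpT
        · rw [hbig, mem_filter, mem_union, mem_sup]
          exact ⟨Or.inl ⟨v, hv, by tauto⟩, hpp⟩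
      have hcond : if p ∈ T then p ∉ v ∧ p ∉ w else p ∈ v ∧ p ∈ w := by
        split_ifs <;> tauto
      have h1 := single_le_sum hnn' hpbig
      rw [if_pos ⟨hE, hcond⟩] at h1
      rw [if_pos hE, if_neg (fun h => hg h.2), zero_add]
      exact h1
  -- The rare pieces total at most B/2, less than half of the edge mass, so they are absorbed on the
  -- left; this is the factor 2 in C₁.
  have hEM : edgeMass t D K V W ≤ C₁ * scale t X Y D K := by
    have : Real.exp 16 * P ^ 4 * (X * Y / D ^ 2 * Real.exp (-(t * K))) =
      C₁ * scale t X Y D K / 2 := by rw [hC₁, scale]; ring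
    linarith
  have hEM0 : 0 ≤ edgeMass t D K V W := hB0.trans hlt.le
  have h1 := fourthRoot_mono hEM
  have h2 := fourthRoot_mono hmVW
  rw [fourthRoot_mul hC₁0.le] at h1
  rw [fourthRoot_mul hmV.le] at h2
  have h3 := fourthRoot_nonneg (edgeMass t D K V W)
  have : edgeMass t D K V W ≤ B := by
    -- Interpolation: the power 3/4 of the trivial bound times the power 1/4 of the structured
    -- bound.
    calc edgeMass t D K V W = fourthRoot (edgeMass t D K V W) ^ 3 *
          fourthRoot (edgeMass t D K V W) := by rw [← pow_succ, fourthRoot_pow hEM0]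
      _ ≤ (fourthRoot (mass V) * fourthRoot (mass W)) ^ 3 *
          (fourthRoot C₁ * fourthRoot (scale t X Y D K)) := by gcongr
      _ = B := by rw [hB]; ring
  exact absurd this (not_le.2 hlt)

/-! ### The second moment -/

theorem isPrimeSet_primeFactors (n : ℕ) : IsPrimeSet n.primeFactors :=
  fun _ hp => Nat.prime_of_mem_primeFactors hp

theorem setProd_primeFactors {n : ℕ} (hn : Squarefree n) : setProd n.primeFactors = n := by
  rw [setProd, ← Nat.cast_prod, Nat.prod_primeFactors_of_squarefree hn]

theorem density_primeFactors {n : ℕ} (hn : n ≠ 0) :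
    density n.primeFactors = (n.totient : ℝ) / n := by
  have h : (n : ℝ) ≠ 0 := by exact_mod_cast hn
  have := congrArg (fun x : ℚ => (x : ℝ)) (Nat.totient_eq_mul_prod_factors n)
  push_cast at this
  rw [this, mul_div_cancel_left₀ _ h, density]
  exact prod_congr rfl fun p _ => by rw [one_div]

theorem injOn_primeFactors {S : Finset ℕ} (hS : ∀ q ∈ S, Squarefree q) :
    Set.InjOn Nat.primeFactors (S : Set ℕ) := by
  intro q hq r hr h
  rw [← Nat.prod_primeFactors_of_squarefree (hS q hq),
    ← Nat.prod_primeFactors_of_squarefree (hS r hr), h]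

theorem setProd_inter_primeFactors {q r : ℕ} (hq : Squarefree q) (hr : Squarefree r) :
    setProd (q.primeFactors ∩ r.primeFactors) = (Nat.gcd q r : ℝ) := by
  rw [← Nat.primeFactors_gcd hq.ne_zero hr.ne_zero,
    setProd_primeFactors (hq.squarefree_of_dvd (Nat.gcd_dvd_left q r))]

theorem mul_div_gcd_sq (q r : ℕ) :
    q * r / Nat.gcd q r ^ 2 = (q / Nat.gcd q r) * (r / Nat.gcd q r) := by
  rw [sq, Nat.mul_div_mul_comm (Nat.gcd_dvd_left q r) (Nat.gcd_dvd_right q r)]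

theorem primeFactors_div_gcd {q : ℕ} (hq : Squarefree q) {r : ℕ} (hr : r ≠ 0) :
    (q / Nat.gcd q r).primeFactors = q.primeFactors \ r.primeFactors := by
  obtain ⟨a, ha⟩ := Nat.gcd_dvd_left q r
  have hg : Nat.gcd q r ≠ 0 := Nat.gcd_ne_zero_left hq.ne_zero
  have hdiv : q / Nat.gcd q r = a := Nat.div_eq_of_eq_mul_right (Nat.pos_of_ne_zero hg) ha
  have hcop : (Nat.gcd q r).Coprime a := Nat.coprime_of_squarefree_mul (ha ▸ hq)
  have ha0 : a ≠ 0 := by rintro rfl; exact hq.ne_zero (by rw [ha, mul_zero])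
  rw [hdiv]
  ext p
  rw [mem_sdiff, Nat.mem_primeFactors, Nat.mem_primeFactors, Nat.mem_primeFactors]
  constructor
  · rintro ⟨hp, hpa, _⟩
    have hpq : p ∣ q := ha ▸ hpa.mul_left _
    refine ⟨⟨hp, hpq, hq.ne_zero⟩, fun h => ?_⟩
    exact Nat.Prime.not_coprime_iff_dvd.2 ⟨p, hp, Nat.dvd_gcd hpq h.2.1, hpa⟩ hcop
  · rintro ⟨⟨hp, hpq, _⟩, h⟩
    refine ⟨hp, ?_, ha0⟩
    rw [ha] at hpq
    exact (hp.dvd_mul.1 hpq).resolve_left fun h' =>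
      h ⟨hp, h'.trans (Nat.gcd_dvd_right q r), hr⟩

theorem primeFactors_mul_div_gcd_sq {q r : ℕ} (hq : Squarefree q) (hr : Squarefree r) :
    (q * r / Nat.gcd q r ^ 2).primeFactors = symmDiff q.primeFactors r.primeFactors := by
  have hg : 0 < Nat.gcd q r := Nat.gcd_pos_of_pos_left _ (Nat.pos_of_ne_zero hq.ne_zero)
  rw [mul_div_gcd_sq, Nat.primeFactors_mul, primeFactors_div_gcd hq hr.ne_zero, Nat.gcd_comm,
    primeFactors_div_gcd hr hq.ne_zero]
  · rfl
  · exact (Nat.div_pos (Nat.gcd_le_left _ (Nat.pos_of_ne_zero hq.ne_zero)) hg).ne'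
  · exact (Nat.div_pos (Nat.gcd_le_right _ (Nat.pos_of_ne_zero hr.ne_zero)) hg).ne'

theorem primeRecipSum_eq {q r : ℕ} (hq : Squarefree q) (hr : Squarefree r) (z : ℝ) :
    primeRecipSum (q * r / Nat.gcd q r ^ 2) z =
      recipSum z (symmDiff q.primeFactors r.primeFactors) := by
  rw [primeRecipSum, primeFactors_mul_div_gcd_sq hq hr]; rfl

/-! ### Reciprocal sums at dyadic scales -/

theorem recipSum_anti {s t : ℝ} (h : s ≤ t) (u : Finset ℕ) : recipSum t u ≤ recipSum s u :=
  sum_le_sum_of_subset_of_nonneg (monotone_filter_right _ fun _ _ h' => h.trans_lt h')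
    fun _ _ _ => by positivity

theorem recipSum_le_recipSum_one_add (s : ℝ) (u : Finset ℕ) :
    recipSum s u ≤ recipSum 1 u + 1 := by
  have h1 : recipSum s u ≤ ∑ p ∈ u, 1 / (p : ℝ) :=
    sum_le_sum_of_subset_of_nonneg (filter_subset _ _) fun _ _ _ => by positivity
  rw [← sum_filter_add_sum_filter_not u (fun p : ℕ => (1 : ℝ) < p)] at h1
  refine h1.trans (add_le_add_right ?_ _)
  -- Primality is not assumed here: the elements up to 1 are 0 and 1, contributing 0 (as 1/0 = 0)
  -- and 1.
  calc _ ≤ ∑ p ∈ range 2, 1 / (p : ℝ) := by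
        refine sum_le_sum_of_subset_of_nonneg (fun p hp => ?_) fun _ _ _ => by positivity
        have h2 := (mem_filter.1 hp).2
        rw [not_lt] at h2
        have h3 : p ≤ 1 := by exact_mod_cast h2
        exact mem_range.2 (by omega)
    _ = 1 := by simp [sum_range_succ]

/-- A dyadic block (2^i, 2^(i+1)] has 2^i integers, each with reciprocal below 2^(-i). This crude
bound, linear in the number of blocks, is enough. -/
theorem recipSum_two_pow_le (i : ℕ) (u : Finset ℕ) :
    recipSum (2 ^ i) u ≤ recipSum (2 ^ (i + 1)) u + 1 := by
  have h0 : recipSum (2 ^ i) u = ∑ p ∈ u with (2 : ℝ) ^ (i + 1) < (p : ℕ), 1 / (p : ℝ) +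
      ∑ p ∈ u with (2 : ℝ) ^ i < (p : ℕ) ∧ ¬ (2 : ℝ) ^ (i + 1) < (p : ℕ), 1 / (p : ℝ) := by
    rw [recipSum, ← sum_filter_add_sum_filter_not _ (fun p : ℕ => (2 : ℝ) ^ (i + 1) < p),
      filter_filter, filter_filter]
    congr 2
    ext p
    simp only [mem_filter, and_congr_right_iff, and_iff_right_iff_imp]
    intro _ h
    exact lt_of_le_of_lt (pow_le_pow_right₀ (by norm_num) (Nat.le_succ i)) h
  rw [h0]
  refine add_le_add_right ?_ _
  calc _ ≤ ∑ p ∈ Ioc (2 ^ i) (2 ^ (i + 1)), 1 / (2 : ℝ) ^ i := by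
        refine (sum_le_sum (g := fun _ => 1 / (2 : ℝ) ^ i) fun p hp => ?_).trans
          (sum_le_sum_of_subset_of_nonneg (fun p hp => ?_) fun _ _ _ => by positivity)
        · have := (mem_filter.1 hp).2.1
          gcongr
        · have := (mem_filter.1 hp).2
          rw [mem_Ioc]
          exact ⟨by exact_mod_cast this.1, by exact_mod_cast not_lt.1 this.2⟩
    _ = 1 := by
        rw [sum_const, Nat.card_Ioc, nsmul_eq_mul, pow_succ]
        have : 2 ^ i * 2 - 2 ^ i = 2 ^ i := by omega
        rw [this]
        push_cast
        field_simp

theorem recipSum_le_two_pow (s : ℝ) (j : ℕ) (u : Finset ℕ) :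
    recipSum s u ≤ recipSum (2 ^ j) u + (j + 1) := by
  induction j with
  | zero => simpa using recipSum_le_recipSum_one_add s u
  | succ j ih =>
    have := recipSum_two_pow_le j u
    push_cast
    linarith

theorem recipSum_eq_zero {t : ℝ} {u : Finset ℕ} (h : ∀ p ∈ u, (p : ℝ) ≤ t) : recipSum t u = 0 := by
  rw [recipSum, filter_false_of_mem fun p hp => not_lt.2 (h p hp), sum_empty]

/-- Either the reciprocal sum is bounded or it is controlled at a dyadic scale. -/
theorem recipSum_dichotomy (s : ℝ) (u : Finset ℕ) :
    recipSum s u ≤ 22 ∨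
      ∃ j : ℕ, s ≤ 2 ^ j ∧ 20 ≤ recipSum (2 ^ j) u ∧ recipSum s u ≤ 22 + j := by
  have hex : ∃ j : ℕ, recipSum (2 ^ j) u < 20 := by
    obtain ⟨n, hn⟩ := u.exists_nat_subset_range
    refine ⟨n, ?_⟩
    rw [recipSum_eq_zero]
    · norm_num
    · intro p hp
      have h1 := (mem_range.1 (hn hp)).trans (Nat.lt_two_pow_self (n := n))
      exact_mod_cast h1.le
  classical
  -- Take the first dyadic scale with sum below 20. If it is 2^(i+1), the scale 2^i still carries at
  -- least 20, and descending from 2^(i+1) to s adds at most i + 2, whence 22 + i.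
  have hj := Nat.find_spec hex
  have hmin := fun i => Nat.find_min hex (m := i)
  generalize Nat.find hex = j at hj hmin
  rcases j with _ | i
  · left
    have := recipSum_le_two_pow s 0 u
    push_cast at this
    linarith
  · have h20 := not_lt.1 (hmin i (Nat.lt_succ_self i))
    rcases le_or_gt s (2 ^ i) with h | h
    · right
      refine ⟨i, h, h20, ?_⟩
      have := recipSum_le_two_pow s (i + 1) u
      push_cast at this
      linarith
    · left
      have h1 := recipSum_anti h.le u
      have h2 := recipSum_two_pow_le i u
      linarith

/-- The weight of the pairs in `S` that are close at scale `t`. -/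
theorem exists_sum_edges_le : ∃ C : ℝ, 0 < C ∧ ∀ t : ℝ, 1 ≤ t →
    ∀ (Q N : ℝ) (S : Finset ℕ), 0 < N → 0 < Q →
      (∀ q ∈ S, (q : ℝ) ≤ 2 * Q ∧ Squarefree q) →
      ∑ q ∈ S, (Nat.totient q : ℝ) / (q : ℝ) ≤ N →
      ∑ q ∈ S, ∑ r ∈ S,
        (if IsEdge t (Q / (N * Real.exp (6 * t))) 20 q.primeFactors r.primeFactors then
          (Nat.totient q : ℝ) / q * ((Nat.totient r : ℝ) / r) else 0) ≤
        C * N ^ 2 * Real.exp (-(2 * t)) := by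
  obtain ⟨C, hC, h⟩ := exists_bilinearBound
  have h4 := fourthRoot_pos (show (0 : ℝ) < 4 by norm_num)
  refine ⟨C * fourthRoot 4, by positivity, fun t ht Q N S hN hQ hS hle => ?_⟩
  have hsq : ∀ q ∈ S, Squarefree q := fun q hq => (hS q hq).2
  have hinj := injOn_primeFactors hsq
  set V := S.image Nat.primeFactors with hV
  have hVp : ∀ v ∈ V, IsPrimeSet v := by
    intro v hv
    obtain ⟨q, _, rfl⟩ := mem_image.1 hv
    exact isPrimeSet_primeFactors q
  have hVX : ∀ v ∈ V, setProd v ≤ 2 * Q := by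
    intro v hv
    obtain ⟨q, hq, rfl⟩ := mem_image.1 hv
    rw [setProd_primeFactors (hsq q hq)]
    exact (hS q hq).1
  have hmass : mass V ≤ N := by
    refine le_of_eq_of_le ?_ hle
    rw [mass, sum_image hinj]
    exact sum_congr rfl fun q hq => density_primeFactors (hsq q hq).ne_zero
  have hb := h t ht V V hVp hVp (2 * Q) (2 * Q) (Q / (N * Real.exp (6 * t))) 20 (by positivity)
    (by positivity) (by positivity) hVX hVX
  have heq : edgeMass t (Q / (N * Real.exp (6 * t))) 20 V V = ∑ q ∈ S, ∑ r ∈ S,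
        (if IsEdge t (Q / (N * Real.exp (6 * t))) 20 q.primeFactors r.primeFactors then
          (Nat.totient q : ℝ) / q * ((Nat.totient r : ℝ) / r) else 0) := by
    rw [edgeMass, sum_image hinj]
    refine sum_congr rfl fun q hq => ?_
    rw [sum_image hinj]
    refine sum_congr rfl fun r hr => ?_
    rw [density_primeFactors (hsq q hq).ne_zero, density_primeFactors (hsq r hr).ne_zero]
  rw [← heq]
  refine hb.trans ?_
  -- The factor e^(12t) from D⁻² meets e^(-20t), leaving e^(-8t), whose fourth root is e^(-2t). The
  -- choice K = 20 has to beat the 12.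
  have hscale : scale t (2 * Q) (2 * Q) (Q / (N * Real.exp (6 * t))) 20 =
      4 * (N * (N * Real.exp (-(2 * t)) ^ 4)) := by
    rw [scale, ← Real.exp_nat_mul]
    have e1 : (2 * Q) * (2 * Q) / (Q / (N * Real.exp (6 * t))) ^ 2 =
      4 * N ^ 2 * Real.exp (6 * t) ^ 2 := by field_simp; norm_num
    rw [e1, ← Real.exp_nat_mul, mul_assoc (4 * N ^ 2), ← Real.exp_add]
    have e2 : ((2 : ℕ) : ℝ) * (6 * t) + -(t * 20) = ((4 : ℕ) : ℝ) * -(2 * t) := by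
      push_cast; ring
    rw [e2]; ring
  have hρ := fourthRoot_mono hmass
  have hρ0 := fourthRoot_nonneg (mass V)
  have hN4 := fourthRoot_pow hN.le
  rw [hscale, fourthRoot_mul (by norm_num), fourthRoot_mul hN.le, fourthRoot_mul hN.le,
    fourthRoot_pow_four (Real.exp_pos _).le]
  have hρN := fourthRoot_nonneg N
  calc _ ≤ C * (fourthRoot N * fourthRoot N) ^ 3 *
        (fourthRoot 4 * (fourthRoot N * (fourthRoot N * Real.exp (-(2 * t))))) := by gcongr
    _ = C * fourthRoot 4 * (fourthRoot N ^ 4) ^ 2 * Real.exp (-(2 * t)) := by ring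
    _ = _ := by rw [hN4]

/-- Since 2^j ≥ j + 1, the exponent j - 2 · 2^j is at most -j, which makes the sum over scales
geometric. -/
theorem exp_mul_exp_two_pow_le (j : ℕ) :
    Real.exp (22 + j) * Real.exp (-(2 * 2 ^ j)) ≤ Real.exp 22 * (1 / 2) ^ j := by
  have h1 : ((j : ℝ) + 1) ≤ 2 ^ j := by exact_mod_cast Nat.lt_two_pow_self (n := j)
  have h2 : Real.exp (-1) ≤ 1 / 2 := by
    rw [Real.exp_neg, one_div]
    exact inv_anti₀ (by norm_num) (by linarith [Real.add_one_le_exp 1])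
  calc _ = Real.exp 22 * Real.exp (j - 2 * 2 ^ j) := by
        rw [← Real.exp_add, ← Real.exp_add]; congr 1; ring
    _ ≤ Real.exp 22 * Real.exp (j * (-1)) := by gcongr; linarith
    _ = Real.exp 22 * Real.exp (-1) ^ j := by rw [Real.exp_nat_mul]
    _ ≤ _ := by gcongr

/-- The second moment bound, with an enlarged range of primes. -/
theorem exists_second_moment_le : ∃ C : ℝ, 0 < C ∧
    ∀ (Q N : ℝ) (S : Finset ℕ), 0 < N → 0 < Q →
      (∀ q ∈ S, (q : ℝ) ≤ 2 * Q ∧ Squarefree q) →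
      ∑ q ∈ S, (Nat.totient q : ℝ) / (q : ℝ) ≤ N →
      ∑ q ∈ S, ∑ r ∈ S, (Nat.totient q : ℝ) / q * ((Nat.totient r : ℝ) / r) *
        Real.exp (recipSum (Real.log (Q / (N * (Nat.gcd q r : ℝ))) / 6)
          (symmDiff q.primeFactors r.primeFactors)) ≤ C * N ^ 2 := by
  obtain ⟨C, hC, h⟩ := exists_sum_edges_le
  refine ⟨Real.exp 22 + 2 * C * Real.exp 22, by positivity, fun Q N S hN hQ hS hle => ?_⟩
  have hsq : ∀ q ∈ S, Squarefree q := fun q hq => (hS q hq).2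
  obtain ⟨J, hJ⟩ := S.exists_nat_subset_range
  set ω : ℕ → ℝ := fun q => (Nat.totient q : ℝ) / q with hω
  have hω0 : ∀ q, 0 ≤ ω q := fun q => by simp only [hω]; positivity
  set E : ℕ → ℕ → ℕ → ℝ := fun j q r =>
    if IsEdge (2 ^ j) (Q / (N * Real.exp (6 * 2 ^ j))) 20 q.primeFactors r.primeFactors then
      ω q * ω r else 0 with hE
  have hE0 : ∀ j q r, 0 ≤ E j q r := fun j q r => by
    simp only [hE]
    split_ifs
    · exact mul_nonneg (hω0 q) (hω0 r)
    · rfl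
  have hpt : ∀ q ∈ S, ∀ r ∈ S, ω q * ω r *
      Real.exp (recipSum (Real.log (Q / (N * (Nat.gcd q r : ℝ))) / 6)
          (symmDiff q.primeFactors r.primeFactors)) ≤
      Real.exp 22 * (ω q * ω r) + ∑ j ∈ range J, Real.exp (22 + j) * E j q r := by
    intro q hq r hr
    have hww := mul_nonneg (hω0 q) (hω0 r)
    have hsum0 : ∀ j ∈ range J, 0 ≤ Real.exp (22 + j) * E j q r := fun j _ =>
      mul_nonneg (Real.exp_pos _).le (hE0 j q r)
    rcases recipSum_dichotomy (Real.log (Q / (N * (Nat.gcd q r : ℝ))) / 6)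
          (symmDiff q.primeFactors r.primeFactors) with h1 | ⟨j, h1, h2, h3⟩
    · have : ω q * ω r * Real.exp (recipSum (Real.log (Q / (N * (Nat.gcd q r : ℝ))) / 6)
          (symmDiff q.primeFactors r.primeFactors)) ≤ ω q * ω r * Real.exp 22 := by gcongr
      linarith [sum_nonneg hsum0]
    -- All primes involved are below J, so at a scale 2^j with j ≥ J the reciprocal sum vanishes and
    -- cannot reach 20.
    · have hjJ : j ∈ range J := by
        rw [mem_range]
        by_contra! hJj
        have hz : recipSum (2 ^ j) (symmDiff q.primeFactors r.primeFactors) = 0 := by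
          refine recipSum_eq_zero fun p hp => ?_
          have hpJ : p < J := by
            rw [mem_symmDiff] at hp
            rcases hp with hp | hp
            · exact (Nat.le_of_mem_primeFactors hp.1).trans_lt (mem_range.1 (hJ hq))
            · exact (Nat.le_of_mem_primeFactors hp.1).trans_lt (mem_range.1 (hJ hr))
          have := (hpJ.trans_le hJj).trans (Nat.lt_two_pow_self (n := j))
          exact_mod_cast this.le
        linarith
      have hg : (0 : ℝ) < Nat.gcd q r := by
        exact_mod_cast Nat.gcd_pos_of_pos_left _ (Nat.pos_of_ne_zero (hsq q hq).ne_zero)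
      have hedge : IsEdge (2 ^ j) (Q / (N * Real.exp (6 * 2 ^ j))) 20
          q.primeFactors r.primeFactors := by
        refine ⟨?_, h2⟩
        rw [setProd_inter_primeFactors (hsq q hq) (hsq r hr)]
        -- Exponentiating s ≤ 2^j gives exactly the lower bound on the gcd required of an edge at
        -- scale 2^j.
        have h4 : Real.log (Q / (N * (Nat.gcd q r : ℝ))) ≤ 6 * 2 ^ j := by linarith
        rw [Real.log_le_iff_le_exp (by positivity), div_le_iff₀ (by positivity)] at h4
        rw [div_le_iff₀ (by positivity)]
        linarith
      have h5 := single_le_sum hsum0 hjJ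
      have h6 : E j q r = ω q * ω r := if_pos hedge
      rw [h6] at h5
      have h7 : ω q * ω r * Real.exp (recipSum (Real.log (Q / (N * (Nat.gcd q r : ℝ))) / 6)
          (symmDiff q.primeFactors r.primeFactors)) ≤ ω q * ω r * Real.exp (22 + j) := by gcongr
      have h8 : 0 ≤ Real.exp 22 * (ω q * ω r) := by positivity
      linarith
  calc _ ≤ ∑ q ∈ S, ∑ r ∈ S,
        (Real.exp 22 * (ω q * ω r) + ∑ j ∈ range J, Real.exp (22 + j) * E j q r) :=
        sum_le_sum fun q hq => sum_le_sum fun r hr => hpt q hq r hr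
    _ = Real.exp 22 * ((∑ q ∈ S, ω q) * ∑ r ∈ S, ω r) +
        ∑ j ∈ range J, Real.exp (22 + j) * ∑ q ∈ S, ∑ r ∈ S, E j q r := by
        rw [sum_mul_sum, mul_sum]
        simp only [sum_add_distrib, mul_sum]
        congr 1
        rw [sum_comm (s := range J)]
        exact sum_congr rfl fun q _ => sum_comm
    _ ≤ Real.exp 22 * (N * N) +
        ∑ j ∈ range J, Real.exp (22 + j) * (C * N ^ 2 * Real.exp (-(2 * 2 ^ j))) := by
        have hs0 : 0 ≤ ∑ q ∈ S, ω q := sum_nonneg fun q _ => hω0 q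
        gcongr with j hj
        exact h (2 ^ j) (one_le_pow₀ (by norm_num)) Q N S hN hQ hS hle
    _ = Real.exp 22 * (N * N) + C * N ^ 2 *
        ∑ j ∈ range J, (Real.exp (22 + j) * Real.exp (-(2 * 2 ^ j))) := by
        rw [mul_sum]
        congr 1
        exact sum_congr rfl fun j _ => by ring
    _ ≤ Real.exp 22 * (N * N) + C * N ^ 2 * ∑ j ∈ range J, Real.exp 22 * (1 / 2) ^ j := by
        exact add_le_add_right (mul_le_mul_of_nonneg_left
          (sum_le_sum fun j _ => exp_mul_exp_two_pow_le j) (by positivity)) _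
    _ ≤ Real.exp 22 * (N * N) + C * N ^ 2 * (Real.exp 22 * 2) := by
        rw [← mul_sum]
        gcongr
        exact sum_geometric_two_le J
    _ = _ := by ring

/-! ### An upper bound sieve -/

theorem inv_one_sub_inv_prime_le {p : ℕ} (hp : p.Prime) :
    (1 - 1 / (p : ℝ))⁻¹ ≤ Real.exp (1 / p + 2 * ((p : ℝ) ^ 2)⁻¹) := by
  have h2 : (2 : ℝ) ≤ p := by exact_mod_cast hp.two_le
  refine le_trans ?_ (Real.add_one_le_exp _)
  rw [inv_le_iff_one_le_mul₀ (one_sub_inv_prime_pos hp)]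
  have : (1 / (p : ℝ) + 2 * ((p : ℝ) ^ 2)⁻¹ + 1) * (1 - 1 / p) - 1 = (p - 2) / p ^ 3 := by
    field_simp; ring
  have h3 : 0 ≤ ((p : ℝ) - 2) / p ^ 3 := div_nonneg (by linarith) (by positivity)
  linarith

/-- Sieving only by p ≤ z loses the factors (1 - 1/p)⁻¹ ≤ exp(1/p + 2/p²) for p > z: the first order
is the reciprocal sum, the second a constant. -/
theorem density_filter_le_le (z : ℝ) {U : Finset ℕ} (hU : IsPrimeSet U) :
    density (U.filter fun p : ℕ => (p : ℝ) ≤ z) ≤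
      Real.exp 4 * (density U * Real.exp (recipSum z U)) := by
  have hsplit : density (U.filter fun p : ℕ => (p : ℝ) ≤ z) *
      density (U.filter fun p : ℕ => z < (p : ℝ)) = density U := by
    have := prod_filter_mul_prod_filter_not U (fun p : ℕ => (p : ℝ) ≤ z)
      (fun p => 1 - 1 / (p : ℝ))
    simp only [not_le] at this
    exact this
  have hpos := (hU.mono (filter_subset (fun p : ℕ => z < (p : ℝ)) U)).density_pos
  have hinv : (density (U.filter fun p : ℕ => z < (p : ℝ)))⁻¹ ≤
      Real.exp 4 * Real.exp (recipSum z U) := by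
    rw [density, ← prod_inv_distrib]
    calc _ ≤ ∏ p ∈ U with z < (p : ℕ), Real.exp (1 / p + 2 * ((p : ℝ) ^ 2)⁻¹) :=
          prod_le_prod (fun p hp => (inv_pos.2 (one_sub_inv_prime_pos
            (hU p (mem_filter.1 hp).1))).le)
            fun p hp => inv_one_sub_inv_prime_le (hU p (mem_filter.1 hp).1)
      _ = Real.exp (2 * ∑ p ∈ U with z < (p : ℕ), ((p : ℝ) ^ 2)⁻¹) *
          Real.exp (recipSum z U) := by
          rw [← Real.exp_sum, sum_add_distrib, ← mul_sum, ← Real.exp_add, add_comm]; rfl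
      _ ≤ _ := by
          gcongr
          have h1 : ∑ p ∈ U with z < (p : ℕ), ((p : ℝ) ^ 2)⁻¹ ≤
              ∑ p ∈ U with (1 : ℝ) < (p : ℕ), ((p : ℝ) ^ 2)⁻¹ :=
            sum_le_sum_of_subset_of_nonneg (fun p hp => by
              rw [mem_filter] at hp ⊢
              exact ⟨hp.1, by exact_mod_cast (hU p hp.1).one_lt⟩) fun _ _ _ => by positivity
          have h2 := sum_inv_sq_gt_le le_rfl U
          linarith
  have hU0 := hU.density_pos
  calc _ = density U * (density (U.filter fun p : ℕ => z < (p : ℝ)))⁻¹ := by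
        rw [← hsplit, mul_inv_cancel_right₀ hpos.ne']
    _ ≤ density U * (Real.exp 4 * Real.exp (recipSum z U)) := by gcongr
    _ = _ := by ring

/-- The number of `h ≤ n` divisible by `d` and coprime to `P`. -/
theorem card_dvd_coprime_le {P d n : ℕ} (hP : 0 < P) (hd : 0 < d) {y H : ℝ} (hy : 0 ≤ y)
    (hyd : y ^ 2 = d) (hPH : (P : ℝ) ^ 3 ≤ H) (hn : (n : ℝ) ≤ H) :
    (((Ioc 0 n).filter fun h => d ∣ h ∧ P.Coprime h).card : ℝ) ≤
      2 * H * ((P.totient : ℝ) / P) / y := by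
  have hP0 : (0 : ℝ) < P := by exact_mod_cast hP
  have hP1 : (1 : ℝ) ≤ P := by exact_mod_cast hP
  have hd1 : (1 : ℝ) ≤ d := by exact_mod_cast hd
  have hy1 : 1 ≤ y := by nlinarith
  have hy0 : 0 < y := by linarith
  have hφ : (1 : ℝ) ≤ P.totient := by exact_mod_cast Nat.totient_pos.2 hP
  have hH0 : 0 ≤ H := (Nat.cast_nonneg n).trans hn
  have hcard : ((Ioc 0 n).filter fun h => d ∣ h ∧ P.Coprime h).card ≤
      ((Ico 1 (1 + n / d)).filter fun k => P.Coprime k).card := by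
    refine card_le_card_of_injOn (fun h => h / d) (fun h hh => ?_) fun h hh h' hh' heq => ?_
    · rw [mem_coe, mem_filter, mem_Ioc] at hh
      obtain ⟨⟨h0, hhn⟩, ⟨k, rfl⟩, hc⟩ := hh
      simp only [mem_coe, mem_filter, mem_Ico, Nat.mul_div_cancel_left _ hd]
      refine ⟨⟨Nat.pos_of_mul_pos_left h0, ?_⟩, hc.coprime_mul_left_right⟩
      have : k ≤ n / d := (Nat.le_div_iff_mul_le hd).2 (by rwa [mul_comm])
      omega
    · rw [mem_coe, mem_filter] at hh hh'
      rw [← Nat.div_mul_cancel hh.2.1, ← Nat.div_mul_cancel hh'.2.1]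
      exact congrArg (· * d) heq
  have hnd : ((n / d : ℕ) : ℝ) ≤ H / d := Nat.cast_div_le.trans (by gcongr)
  have hHdy : H / d * y = H / y := by rw [← hyd]; field_simp
  -- Claiming only a saving y = √d removes any size condition on d. If y ≥ P, dropping coprimality
  -- costs at most P ≤ y. Otherwise H/d ≥ H/P² ≥ P, and counting whole periods modulo P loses only a
  -- factor 2.
  rcases le_total (P : ℝ) y with hPy | hPy
  · calc _ ≤ (((Ico 1 (1 + n / d)).filter fun k => P.Coprime k).card : ℝ) := by exact_mod_cast hcard
      _ ≤ ((n / d : ℕ) : ℝ) := by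
          have := card_filter_le (Ico 1 (1 + n / d)) fun k => P.Coprime k
          rw [Nat.card_Ico] at this
          rw [Nat.add_sub_cancel_left] at this
          exact_mod_cast this
      _ ≤ H / d := hnd
      _ = H / y * (1 / y) := by rw [← hyd]; field_simp
      _ ≤ H / y * (2 * (P.totient / P)) := by
          gcongr
          calc 1 / y ≤ 1 / P := by gcongr
            _ ≤ P.totient / P := by gcongr
            _ ≤ _ := by
              have : (0 : ℝ) ≤ P.totient / P := by positivity
              linarith
      _ = _ := by ring
  · have hPd : (P : ℝ) ≤ H / d := by
      rw [le_div_iff₀ (by linarith), ← hyd]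
      calc (P : ℝ) * y ^ 2 ≤ (P : ℝ) * (P : ℝ) ^ 2 := by gcongr
        _ = (P : ℝ) ^ 3 := by ring
        _ ≤ H := hPH
    calc _ ≤ (((Ico 1 (1 + n / d)).filter fun k => P.Coprime k).card : ℝ) := by exact_mod_cast hcard
      _ ≤ ((P.totient * (n / d / P + 1) : ℕ) : ℝ) := by
          exact_mod_cast Nat.Ico_filter_coprime_le 1 (n / d) hP.ne'
      _ ≤ P.totient * (H / d / P + 1) := by
          push_cast
          gcongr
          exact Nat.cast_div_le.trans (by gcongr)
      _ = P.totient / P * (H / d + P) := by field_simp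
      _ ≤ P.totient / P * (H / d + H / d) := by gcongr
      _ = 2 * (P.totient / P) * (H / d * 1) := by ring
      _ ≤ 2 * (P.totient / P) * (H / d * y) := by gcongr
      _ = _ := by rw [hHdy]; ring

/-- The multiplicative weight `∏ p / (p - 1)` over `p ∈ R` dividing `h`. -/
noncomputable def divWeight (R : Finset ℕ) (h : ℕ) : ℝ :=
  ∏ p ∈ R, if p ∣ h then 1 + 1 / ((p : ℝ) - 1) else 1

theorem divWeight_nonneg {R : Finset ℕ} (hR : IsPrimeSet R) (h : ℕ) : 0 ≤ divWeight R h := by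
  refine prod_nonneg fun p hp => ?_
  have : (1 : ℝ) < p := by exact_mod_cast (hR p hp).one_lt
  have : 0 < 1 / ((p : ℝ) - 1) := by apply one_div_pos.2; linarith
  split_ifs <;> linarith

theorem divWeight_expand {R : Finset ℕ} (hR : IsPrimeSet R) (h : ℕ) :
    divWeight R h = ∑ u ∈ R.powerset, if ∏ p ∈ u, p ∣ h then ∏ p ∈ u, 1 / ((p : ℝ) - 1) else 0 := by
  rw [divWeight, ← prod_filter, prod_one_add, ← sum_filter]
  refine sum_congr ?_ fun _ _ => rfl
  ext u
  rw [mem_powerset, mem_filter, mem_powerset]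
  have hsub : u ⊆ R.filter (· ∣ h) ↔ u ⊆ R ∧ ∀ p ∈ u, p ∣ h := by
    simp only [subset_iff, mem_filter]
    exact forall₂_and
  rw [hsub]
  refine and_congr_right fun hu => ⟨fun hd => ?_, fun hd p hp => (dvd_prod_of_mem _ hp).trans hd⟩
  exact prod_primes_dvd h (fun p hp => (hR p (hu hp)).prime) hd

theorem exists_prod_one_add_le : ∃ C : ℝ, 0 < C ∧ ∀ R : Finset ℕ, IsPrimeSet R →
    ∏ p ∈ R, (1 + 1 / ((p : ℝ) - 1) / √p) ≤ C := by
  have hs : Summable fun n : ℕ => 2 * (1 / (n : ℝ) ^ (3 / 2 : ℝ)) :=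
    (Real.summable_one_div_nat_rpow.2 (by norm_num)).mul_left 2
  refine ⟨Real.exp (∑' n : ℕ, 2 * (1 / (n : ℝ) ^ (3 / 2 : ℝ))), Real.exp_pos _, fun R hR => ?_⟩
  calc _ ≤ ∏ p ∈ R, Real.exp (2 * (1 / (p : ℝ) ^ (3 / 2 : ℝ))) := by
        refine prod_le_prod (fun p hp => ?_) fun p hp => ?_
        · have : (1 : ℝ) < p := by exact_mod_cast (hR p hp).one_lt
          have : 0 < (p : ℝ) - 1 := by linarith
          positivity
        · have h2 : (2 : ℝ) ≤ p := by exact_mod_cast (hR p hp).two_le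
          have h1 : 1 / ((p : ℝ) - 1) ≤ 2 / p := by
            rw [div_le_div_iff₀ (by linarith) (by linarith)]; linarith
          rw [add_comm]
          refine le_trans ?_ (Real.add_one_le_exp _)
          gcongr
          calc 1 / ((p : ℝ) - 1) / √p ≤ 2 / p / √p := by gcongr
            _ = _ := by
              rw [show (3 / 2 : ℝ) = 1 + 1 / 2 by norm_num, Real.rpow_add (by linarith),
                Real.rpow_one, ← Real.sqrt_eq_rpow]
              field_simp
    _ = Real.exp (∑ p ∈ R, 2 * (1 / (p : ℝ) ^ (3 / 2 : ℝ))) := (Real.exp_sum _ _).symm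
    _ ≤ _ := by
        gcongr
        exact hs.sum_le_tsum R fun _ _ => by positivity

/-- Expand the weight over divisors. The saving √d per divisor already makes the Euler product with
factors 1 + 1/((p - 1)√p) bounded. -/
theorem exists_sum_divWeight_coprime_le : ∃ C : ℝ, 0 < C ∧ ∀ R : Finset ℕ, IsPrimeSet R →
    ∀ (P n : ℕ) (H : ℝ), 0 < P → (P : ℝ) ^ 3 ≤ H → (n : ℝ) ≤ H →
      ∑ h ∈ Ioc 0 n with P.Coprime h, divWeight R h ≤ C * H * ((P.totient : ℝ) / P) := by
  obtain ⟨C, hC, hprod⟩ := exists_prod_one_add_le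
  refine ⟨2 * C, by positivity, fun R hR P n H hP hPH hn => ?_⟩
  have hH0 : 0 ≤ H := (Nat.cast_nonneg n).trans hn
  have hx : ∀ u ⊆ R, 0 ≤ ∏ p ∈ u, 1 / ((p : ℝ) - 1) := fun u hu => prod_nonneg fun p hp => by
    have : (1 : ℝ) < p := by exact_mod_cast (hR p (hu hp)).one_lt
    have : 0 < (p : ℝ) - 1 := by linarith
    positivity
  calc ∑ h ∈ Ioc 0 n with P.Coprime h, divWeight R h
      = ∑ u ∈ R.powerset, (((Ioc 0 n).filter fun h => ∏ p ∈ u, p ∣ h ∧ P.Coprime h).card : ℝ) *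
          ∏ p ∈ u, 1 / ((p : ℝ) - 1) := by
        simp only [divWeight_expand hR]
        rw [sum_comm]
        refine sum_congr rfl fun u _ => ?_
        rw [← sum_filter, sum_const, nsmul_eq_mul, filter_filter]
        simp only [and_comm]
    _ ≤ ∑ u ∈ R.powerset, 2 * H * ((P.totient : ℝ) / P) / (∏ p ∈ u, √(p : ℝ)) *
          ∏ p ∈ u, 1 / ((p : ℝ) - 1) := by
        refine sum_le_sum fun u hu => ?_
        rw [mem_powerset] at hu
        refine mul_le_mul_of_nonneg_right ?_ (hx u hu)
        refine card_dvd_coprime_le hP (prod_pos fun p hp => (hR p (hu hp)).pos)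
          (prod_nonneg fun _ _ => Real.sqrt_nonneg _) ?_ hPH hn
        rw [← prod_pow, Nat.cast_prod]
        exact prod_congr rfl fun p _ => Real.sq_sqrt (Nat.cast_nonneg p)
    _ = 2 * H * ((P.totient : ℝ) / P) * ∏ p ∈ R, (1 + 1 / ((p : ℝ) - 1) / √p) := by
        rw [prod_one_add, mul_sum]
        refine sum_congr rfl fun u _ => ?_
        have : ∏ p ∈ u, 1 / ((p : ℝ) - 1) / √p =
          (∏ p ∈ u, 1 / ((p : ℝ) - 1)) / ∏ p ∈ u, √(p : ℝ) := prod_div_distrib _ _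
        rw [this]; ring
    _ ≤ 2 * H * ((P.totient : ℝ) / P) * C := by
        gcongr
        exact hprod R hR
    _ = _ := by ring

/-- The primorial of z is at most 4^z ≤ e^(2z), with cube e^(6z); this is the origin of the 6 in the
threshold (log H)/6. -/
theorem prod_filter_le_cube_le {U : Finset ℕ} (hU : IsPrimeSet U) {H : ℝ} (hH : 1 ≤ H) :
    ((∏ p ∈ U.filter (fun p : ℕ => (p : ℝ) ≤ Real.log H / 6), p : ℕ) : ℝ) ^ 3 ≤ H := by
  set z := Real.log H / 6 with hz
  have hz0 : 0 ≤ z := div_nonneg (Real.log_nonneg hH) (by norm_num)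
  have h1 : ∏ p ∈ U.filter (fun p : ℕ => (p : ℝ) ≤ z), p ≤ primorial ⌊z⌋₊ := by
    rw [primorial]
    refine prod_le_prod_of_subset_of_one_le' (fun p hp => ?_) fun p hp _ =>
      (mem_filter.1 hp).2.one_le
    rw [mem_filter] at hp ⊢
    rw [mem_range, Nat.lt_succ_iff]
    exact ⟨Nat.le_floor hp.2, hU p hp.1⟩
  have h2 : ((∏ p ∈ U.filter (fun p : ℕ => (p : ℝ) ≤ z), p : ℕ) : ℝ) ≤ 4 ^ ⌊z⌋₊ := by
    exact_mod_cast h1.trans (primorial_le_four_pow _)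
  have h4 : (4 : ℝ) ≤ Real.exp 2 := by
    have : (2 : ℝ) ≤ Real.exp 1 := by linarith [Real.add_one_le_exp 1]
    rw [show (2 : ℝ) = 1 + 1 by norm_num, Real.exp_add]
    nlinarith
  have h5 : (4 : ℝ) ^ ⌊z⌋₊ ≤ Real.exp (2 * z) := by
    calc (4 : ℝ) ^ ⌊z⌋₊ ≤ Real.exp 2 ^ ⌊z⌋₊ := by gcongr
      _ = Real.exp (⌊z⌋₊ * 2) := by rw [Real.exp_nat_mul]
      _ ≤ Real.exp (2 * z) := by
        exact Real.exp_le_exp.2 (by linarith [Nat.floor_le hz0])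
  calc _ ≤ (Real.exp (2 * z)) ^ 3 := by
        gcongr
        exact h2.trans h5
    _ = Real.exp (Real.log H) := by
        rw [← Real.exp_nat_mul]; congr 1; rw [hz]; push_cast; ring
    _ = H := Real.exp_log (by linarith)

/-- Upper bound sieve for integers free of prime factors from `U`. -/
theorem exists_sieve_bound : ∃ C : ℝ, 0 < C ∧ ∀ R U : Finset ℕ, IsPrimeSet R → IsPrimeSet U →
    ∀ H : ℝ, 0 ≤ H →
      ∑ h ∈ Ioc 0 ⌊H⌋₊ with (∀ p ∈ U, ¬ p ∣ h), divWeight R h ≤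
        C * H * (density U * Real.exp (recipSum (Real.log H / 6) U)) := by
  obtain ⟨C, hC, h⟩ := exists_sum_divWeight_coprime_le
  refine ⟨C * Real.exp 4, by positivity, fun R U hR hU H hH => ?_⟩
  have hU0 := hU.density_pos
  rcases lt_or_ge H 1 with h1 | h1
  · rw [Nat.floor_eq_zero.2 h1]
    simp only [Ioc_self, filter_empty, sum_empty]
    positivity
  set F := U.filter (fun p : ℕ => (p : ℝ) ≤ Real.log H / 6) with hF
  have hFp : IsPrimeSet F := hU.mono (filter_subset _ _)
  have hP : 0 < ∏ p ∈ F, p := prod_pos fun p hp => (hFp p hp).pos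
  calc _ ≤ ∑ h ∈ Ioc 0 ⌊H⌋₊ with (∏ p ∈ F, p).Coprime h, divWeight R h := by
        refine sum_le_sum_of_subset_of_nonneg (fun k hk => ?_) fun k _ _ => divWeight_nonneg hR k
        rw [mem_filter] at hk ⊢
        refine ⟨hk.1, Nat.Coprime.prod_left fun p hp => ?_⟩
        exact ((hFp p hp).coprime_iff_not_dvd).2 (hk.2 p (mem_filter.1 hp).1)
    _ ≤ C * H * (((∏ p ∈ F, p).totient : ℝ) / (∏ p ∈ F, p : ℕ)) :=
        h R hR _ _ H hP (prod_filter_le_cube_le hU h1) (Nat.floor_le hH)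
    _ = C * H * density F := by
        rw [← density_primeFactors hP.ne', Nat.primeFactors_prod hFp]
    _ ≤ C * H * (Real.exp 4 * (density U * Real.exp (recipSum (Real.log H / 6) U))) := by
        gcongr
        exact density_filter_le_le _ hU
    _ = _ := by ring

/-! ### Counting nearby reduced fractions -/

/-- Pairs of numerators of reduced fractions with denominators `g * a` and `g * b` whose difference
is `h / (g * a * b)`. -/
def numeratorPairs (g a b : ℕ) (h : ℤ) : Finset (ℕ × ℕ) :=
  (range (g * a) ×ˢ range (g * b)).filter fun z =>
    z.1.Coprime (g * a) ∧ z.2.Coprime (g * b) ∧ (z.1 : ℤ) * b - z.2 * a = h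

/-- If p divides a and h = xb - ya, then p divides xb, hence x, against reducedness; likewise for b.
So only h coprime to ab occur, which is the sieve condition. -/
theorem numeratorPairs_eq_empty_of_dvd {g a b : ℕ} {h : ℤ} (hab : a.Coprime b) {p : ℕ}
    (hp : p.Prime) (hpab : p ∣ a ∨ p ∣ b) (hph : (p : ℤ) ∣ h) : numeratorPairs g a b h = ∅ := by
  rw [numeratorPairs, filter_eq_empty_iff]
  rintro ⟨x, y⟩ - ⟨hx, hy, he⟩
  dsimp only at hx hy he
  have hnot : ¬ (p ∣ a ∧ p ∣ b) := fun h' => Nat.Prime.not_coprime_iff_dvd.2 ⟨p, hp, h'⟩ hab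
  rcases hpab with hpa | hpb
  · have h1 : (p : ℤ) ∣ x * b := by
      have : (x : ℤ) * b = h + y * a := by linarith
      rw [this]
      exact dvd_add hph ((Int.natCast_dvd_natCast.2 hpa).mul_left _)
    rcases (hp.dvd_mul).1 (by exact_mod_cast h1 : p ∣ x * b) with h2 | h2
    · exact Nat.Prime.not_coprime_iff_dvd.2 ⟨p, hp, h2, hpa.mul_left g⟩ hx
    · exact hnot ⟨hpa, h2⟩
  · have h1 : (p : ℤ) ∣ y * a := by
      have : (y : ℤ) * a = x * b - h := by linarith
      rw [this]
      exact dvd_sub ((Int.natCast_dvd_natCast.2 hpb).mul_left _) hph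
    rcases (hp.dvd_mul).1 (by exact_mod_cast h1 : p ∣ y * a) with h2 | h2
    · exact Nat.Prime.not_coprime_iff_dvd.2 ⟨p, hp, h2, hpb.mul_left g⟩ hy
    · exact hnot ⟨h2, hpb⟩

/-- The residues 0 and h/b are forbidden. They coincide when p divides h, leaving p - 1 classes, an
exact equality; otherwise p - 2 remain, below p(1 - 1/p)². -/
theorem card_residues_le {p : ℕ} (hp : p.Prime) {b : ℕ} (hb : ¬ p ∣ b) (h : ℤ) :
    ((((range p).filter fun x : ℕ => x ≠ 0 ∧ ¬ (p : ℤ) ∣ x * b - h).card : ℕ) : ℝ) ≤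
      (1 - 1 / (p : ℝ)) ^ 2 * p * if (p : ℤ) ∣ h then 1 + 1 / ((p : ℝ) - 1) else 1 := by
  have hp2 : (2 : ℝ) ≤ p := by exact_mod_cast hp.two_le
  have hsub : ((range p).filter fun x : ℕ => x ≠ 0 ∧ ¬ (p : ℤ) ∣ x * b - h) ⊆
      (range p).erase 0 := fun x hx => by
    rw [mem_filter] at hx
    exact mem_erase.2 ⟨hx.2.1, hx.1⟩
  have hcard : ((range p).erase 0).card = p - 1 := by
    rw [card_erase_of_mem (mem_range.2 hp.pos), card_range]
  split_ifs with hph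
  · have h1 := card_le_card hsub
    rw [hcard] at h1
    have h2 : (1 - 1 / (p : ℝ)) ^ 2 * p * (1 + 1 / ((p : ℝ) - 1)) = ((p - 1 : ℕ) : ℝ) := by
      have : (p : ℝ) - 1 ≠ 0 := by linarith
      rw [Nat.cast_sub hp.one_le]
      push_cast
      field_simp
      ring
    rw [h2]
    exact_mod_cast h1
  · obtain ⟨c, hc⟩ : ∃ c : ℤ, (p : ℤ) ∣ c * b - h := by
      have hcop : IsCoprime (b : ℤ) (p : ℤ) :=
        Nat.isCoprime_iff_coprime.2 ((hp.coprime_iff_not_dvd.2 hb).symm)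
      obtain ⟨u, v, huv⟩ := hcop
      exact ⟨h * u, -(h * v), by linear_combination h * huv⟩
    have hp0 : (p : ℤ) ≠ 0 := by exact_mod_cast hp.ne_zero
    have hd0 : 0 ≤ c % p := Int.emod_nonneg _ hp0
    obtain ⟨d, hd⟩ := Int.eq_ofNat_of_zero_le hd0
    have hdp : d < p := by
      have := Int.emod_lt_of_pos c (by exact_mod_cast hp.pos : (0 : ℤ) < p)
      rw [hd] at this
      exact_mod_cast this
    have hdd : (p : ℤ) ∣ d * b - h := by
      have h3 : (d : ℤ) * b - h = (c * b - h) - p * (c / p * b) := by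
        have := Int.emod_add_mul_ediv c p
        rw [hd] at this
        change (d : ℤ) + _ = _ at this
        linear_combination b * this
      rw [h3]
      exact dvd_sub hc (dvd_mul_right _ _)
    have hdne : d ≠ 0 := by
      rintro rfl
      apply hph
      simpa using hdd
    have hsub' : ((range p).filter fun x : ℕ => x ≠ 0 ∧ ¬ (p : ℤ) ∣ x * b - h) ⊆
        ((range p).erase 0).erase d := fun x hx => by
      refine mem_erase.2 ⟨?_, hsub hx⟩
      rintro rfl
      exact (mem_filter.1 hx).2.2 hdd
    have h1 := card_le_card hsub'
    rw [card_erase_of_mem (mem_erase.2 ⟨hdne, mem_range.2 hdp⟩), hcard] at h1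
    have h2 : ((p - 1 - 1 : ℕ) : ℝ) = p - 2 := by
      rw [Nat.sub_sub, Nat.cast_sub hp.two_le]; norm_num
    have h3 : (1 - 1 / (p : ℝ)) ^ 2 * p * 1 = p - 2 + 1 / p := by
      field_simp; ring
    have h4 : 0 ≤ 1 / (p : ℝ) := by positivity
    have h5 : ((((range p).filter fun x : ℕ => x ≠ 0 ∧ ¬ (p : ℤ) ∣ x * b - h).card : ℕ) : ℝ) ≤
      ((p - 1 - 1 : ℕ) : ℝ) := by exact_mod_cast h1
    linarith

theorem prod_primeFactors_dvd_int {g : ℕ} (hg : Squarefree g) {n : ℤ}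
    (h : ∀ p ∈ g.primeFactors, (p : ℤ) ∣ n) : (g : ℤ) ∣ n := by
  rw [Int.natCast_dvd, ← Nat.prod_primeFactors_of_squarefree hg]
  exact prod_primes_dvd _ (fun p hp => (Nat.prime_of_mem_primeFactors hp).prime)
    fun p hp => Int.natCast_dvd.1 (h p hp)

/-- The value h fixes x modulo a, so x is determined by its residues modulo the primes of g, and
then y by x and h. Reducedness of x and of y each forbids one class modulo every such prime. -/
theorem card_numeratorPairs_le {g a b : ℕ} (hga : Squarefree (g * a)) (hgb : Squarefree (g * b))
    (hab : a.Coprime b) (h : ℤ) :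
    ((numeratorPairs g a b h).card : ℝ) ≤
      density g.primeFactors ^ 2 * g * divWeight g.primeFactors h.natAbs := by
  have hg : Squarefree g := hga.squarefree_of_dvd (dvd_mul_right g a)
  have hgac : g.Coprime a := Nat.coprime_of_squarefree_mul hga
  have hgbc : g.Coprime b := Nat.coprime_of_squarefree_mul hgb
  have ha0 : a ≠ 0 := by rintro rfl; exact hga.ne_zero (mul_zero g)
  have hnot : ∀ p ∈ g.primeFactors, ∀ c, g.Coprime c → ¬ p ∣ c := fun p hp c hc hpc =>
    Nat.Prime.not_coprime_iff_dvd.2 ⟨p, Nat.prime_of_mem_primeFactors hp,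
      Nat.dvd_of_mem_primeFactors hp, hpc⟩ hc
  have hcard : (numeratorPairs g a b h).card ≤ (g.primeFactors.pi fun p =>
      (range p).filter fun x : ℕ => x ≠ 0 ∧ ¬ (p : ℤ) ∣ x * b - h).card := by
    refine card_le_card_of_injOn (fun z p _ => z.1 % p) ?_ ?_
    · rintro ⟨x, y⟩ hz
      rw [mem_coe, numeratorPairs, mem_filter] at hz
      obtain ⟨-, hx, hy, he⟩ := hz
      dsimp only at hx hy he
      rw [mem_coe, mem_pi]
      intro p hp
      have hpp := Nat.prime_of_mem_primeFactors hp
      have hpg := Nat.dvd_of_mem_primeFactors hp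
      rw [mem_filter, mem_range]
      refine ⟨Nat.mod_lt _ hpp.pos, fun h0 => ?_, fun hd => ?_⟩
      · exact Nat.Prime.not_coprime_iff_dvd.2 ⟨p, hpp, Nat.dvd_of_mod_eq_zero h0,
          hpg.mul_right a⟩ hx
      · have h1 : (p : ℤ) ∣ y * a := by
          have h2 : (y : ℤ) * a = ((x % p : ℕ) * b - h) + p * ((x / p : ℕ) * b) := by
            have h3 : ((x % p : ℕ) : ℤ) + p * (x / p : ℕ) = x := by
              exact_mod_cast Nat.mod_add_div x p
            linear_combination -he + (-b : ℤ) * h3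
          rw [h2]
          exact dvd_add hd (dvd_mul_right _ _)
        rcases hpp.dvd_mul.1 (by exact_mod_cast h1 : p ∣ y * a) with h2 | h2
        · exact Nat.Prime.not_coprime_iff_dvd.2 ⟨p, hpp, h2, hpg.mul_right b⟩ hy
        · exact hnot p hp a hgac h2
    · rintro ⟨x, y⟩ hz ⟨x', y'⟩ hz' heq
      rw [mem_coe, numeratorPairs, mem_filter, mem_product, mem_range, mem_range] at hz hz'
      obtain ⟨⟨hxlt, -⟩, -, -, he⟩ := hz
      obtain ⟨⟨hxlt', -⟩, -, -, he'⟩ := hz'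
      dsimp only at hxlt hxlt' he he'
      have hgd : (g : ℤ) ∣ (x : ℤ) - x' := prod_primeFactors_dvd_int hg fun p hp => by
        have h1 : x % p = x' % p := congrFun (congrFun heq p) hp
        exact (Nat.modEq_iff_dvd.1 (show x' ≡ x [MOD p] from h1.symm))
      have had : (a : ℤ) ∣ (x : ℤ) - x' := by
        have h1 : (a : ℤ) ∣ ((x : ℤ) - x') * b := ⟨y - y', by linear_combination he - he'⟩
        exact (Nat.isCoprime_iff_coprime.2 hab).dvd_of_dvd_mul_right h1
      have hd : ((g * a : ℕ) : ℤ) ∣ (x : ℤ) - x' := by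
        push_cast
        exact (Nat.isCoprime_iff_coprime.2 hgac).mul_dvd hgd had
      have hxx : x' = x := (Nat.modEq_iff_dvd.2 hd).eq_of_lt_of_lt hxlt' hxlt
      subst hxx
      have hyy : (y : ℤ) * a = y' * a := by linarith
      have : y = y' := by
        have ha0' : (a : ℤ) ≠ 0 := by exact_mod_cast ha0
        exact_mod_cast mul_right_cancel₀ ha0' hyy
      rw [this]
  have hgprod : ((g : ℝ)) = ∏ p ∈ g.primeFactors, (p : ℝ) := (setProd_primeFactors hg).symm
  calc ((numeratorPairs g a b h).card : ℝ) ≤ _ := Nat.cast_le.2 hcard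
    _ = ∏ p ∈ g.primeFactors, ((((range p).filter fun x : ℕ => x ≠ 0 ∧
          ¬ (p : ℤ) ∣ x * b - h).card : ℕ) : ℝ) := by rw [card_pi, Nat.cast_prod]
    _ ≤ ∏ p ∈ g.primeFactors, ((1 - 1 / (p : ℝ)) ^ 2 * p *
          if p ∣ h.natAbs then 1 + 1 / ((p : ℝ) - 1) else 1) := by
        refine prod_le_prod (fun _ _ => Nat.cast_nonneg _) fun p hp => ?_
        have := card_residues_le (Nat.prime_of_mem_primeFactors hp) (hnot p hp b hgbc) h
        simpa only [Int.natCast_dvd] using this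
    _ = _ := by
        rw [prod_mul_distrib, prod_mul_distrib, prod_pow, ← hgprod]
        rfl

/-- Pairs of distinct reduced fractions with denominators `g * a`, `g * b` at distance less than
`H / (g * a * b)`. -/
noncomputable def nearPairs (g a b : ℕ) (H : ℝ) : Finset (ℕ × ℕ) :=
  (range (g * a) ×ˢ range (g * b)).filter fun z =>
    z.1.Coprime (g * a) ∧ z.2.Coprime (g * b) ∧ |(z.1 : ℝ) * b - z.2 * a| < H

theorem mul_ne_mul_of_reduced {g a b x y : ℕ} (hab : a.Coprime b) (hne : a ≠ b)
    (hx : x.Coprime (g * a)) (hy : y.Coprime (g * b)) : x * b ≠ y * a := by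
  intro he
  have ha : a ∣ x * b := he ▸ dvd_mul_left a y
  have hb : b ∣ y * a := he ▸ dvd_mul_left b x
  have ha1 : a = 1 := Nat.Coprime.eq_one_of_dvd hx.coprime_mul_left_right.symm
    (hab.dvd_of_dvd_mul_right ha)
  have hb1 : b = 1 := Nat.Coprime.eq_one_of_dvd hy.coprime_mul_left_right.symm
    (hab.symm.dvd_of_dvd_mul_right hb)
  exact hne (ha1.trans hb1.symm)

/-- Sort the pairs by h = xb - ya, nonzero because a ≠ b; the factor 2 accounts for its sign. The
sieve then averages the local counts over the h coprime to ab. -/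
theorem exists_card_nearPairs_le : ∃ C : ℝ, 0 < C ∧ ∀ g a b : ℕ, Squarefree (g * a) →
    Squarefree (g * b) → a.Coprime b → a ≠ b → ∀ H : ℝ, 0 ≤ H →
      ((nearPairs g a b H).card : ℝ) ≤ C * (density g.primeFactors ^ 2 * g) *
        (H * (density (a.primeFactors ∪ b.primeFactors) *
          Real.exp (recipSum (Real.log H / 6) (a.primeFactors ∪ b.primeFactors)))) := by
  obtain ⟨C, hC, hsieve⟩ := exists_sieve_bound
  refine ⟨2 * C, by positivity, fun g a b hga hgb hab hne H hH => ?_⟩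
  set U := a.primeFactors ∪ b.primeFactors with hU
  have hUp : IsPrimeSet U := fun p hp => (mem_union.1 hp).elim
    (fun h => Nat.prime_of_mem_primeFactors h) fun h => Nat.prime_of_mem_primeFactors h
  set I := (Ioc 0 ⌊H⌋₊).filter fun h => ∀ p ∈ U, ¬ p ∣ h with hI
  have hcover : nearPairs g a b H ⊆
      I.biUnion fun h => numeratorPairs g a b h ∪ numeratorPairs g a b (-h) := by
    rintro ⟨x, y⟩ hz
    rw [nearPairs, mem_filter] at hz
    obtain ⟨hrange, hx, hy, hlt⟩ := hz
    dsimp only at hx hy hlt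
    set k : ℤ := (x : ℤ) * b - y * a with hk
    have hk0 : k ≠ 0 := fun h0 => mul_ne_mul_of_reduced hab hne hx hy (by
      have : (x : ℤ) * b = y * a := by linarith
      exact_mod_cast this)
    have hkH : (k.natAbs : ℝ) ≤ H := by
      have : ((k.natAbs : ℕ) : ℝ) = |(x : ℝ) * b - y * a| := by
        rw [Nat.cast_natAbs, hk]; push_cast; rfl
      rw [this]; exact hlt.le
    have hmemk : (x, y) ∈ numeratorPairs g a b k := by
      rw [numeratorPairs, mem_filter]
      exact ⟨hrange, hx, hy, rfl⟩
    rw [mem_biUnion]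
    refine ⟨k.natAbs, ?_, ?_⟩
    · rw [hI, mem_filter, mem_Ioc]
      refine ⟨⟨Int.natAbs_pos.2 hk0, Nat.le_floor hkH⟩, fun p hp hpk => ?_⟩
      have hpab : p ∣ a ∨ p ∣ b := (mem_union.1 hp).imp Nat.dvd_of_mem_primeFactors
        Nat.dvd_of_mem_primeFactors
      rw [numeratorPairs_eq_empty_of_dvd hab (hUp p hp) hpab (Int.natCast_dvd.2 hpk)] at hmemk
      exact notMem_empty _ hmemk
    · rw [mem_union]
      rcases Int.natAbs_eq k with h | h
      · left; rwa [← h]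
      · right
        rwa [← h]
  have hcard : ∀ h ∈ I, ((numeratorPairs g a b h ∪ numeratorPairs g a b (-h)).card : ℝ) ≤
      2 * (density g.primeFactors ^ 2 * g * divWeight g.primeFactors h) := by
    intro h _
    have h1 := card_numeratorPairs_le hga hgb hab h
    have h2 := card_numeratorPairs_le hga hgb hab (-h)
    rw [Int.natAbs_neg] at h2
    rw [Int.natAbs_natCast] at h1 h2
    have h3 : ((numeratorPairs g a b h ∪ numeratorPairs g a b (-h)).card : ℝ) ≤
        (numeratorPairs g a b h).card + (numeratorPairs g a b (-h)).card := by
      exact_mod_cast card_union_le _ _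
    linarith
  calc ((nearPairs g a b H).card : ℝ)
      ≤ ∑ h ∈ I, ((numeratorPairs g a b h ∪ numeratorPairs g a b (-h)).card : ℝ) := by
        exact_mod_cast (card_le_card hcover).trans card_biUnion_le
    _ ≤ ∑ h ∈ I, 2 * (density g.primeFactors ^ 2 * g * divWeight g.primeFactors h) :=
        sum_le_sum hcard
    _ = 2 * (density g.primeFactors ^ 2 * g) * ∑ h ∈ I, divWeight g.primeFactors h := by
        rw [mul_sum]; exact sum_congr rfl fun h _ => by ring
    _ ≤ 2 * (density g.primeFactors ^ 2 * g) *
        (C * H * (density U * Real.exp (recipSum (Real.log H / 6) U))) := by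
        gcongr
        exact hsieve _ U (isPrimeSet_primeFactors g) hUp H hH
    _ = _ := by ring

open MeasureTheory

/-! ### Measures of the approximation sets -/

/-- The interval around `x / q` of radius `1 / (q * N)`. -/
def fractionInterval (N : ℝ) (q x : ℕ) : Set ℝ :=
  Set.Ioo ((x : ℝ) / q - 1 / (q * N)) ((x : ℝ) / q + 1 / (q * N))

/-- The approximation set with margin of error `1 / (q * N)`. -/
def approxSet (N : ℝ) (q : ℕ) : Set ℝ := reducedApproxSet (fun k => 1 / ((k : ℝ) * N)) q

/-- For q ≥ 2 the numerators 0 and q are not coprime to q, and the radius is at most 1/q, so no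
interval is cut by [0,1]. -/
theorem approxSet_eq_biUnion {N : ℝ} (hN : 2 ≤ N) {q : ℕ} (hq : 2 ≤ q) :
    approxSet N q = ⋃ x ∈ (range q).filter (·.Coprime q), fractionInterval N q x := by
  have hq0 : (0 : ℝ) < q := by exact_mod_cast (by omega : 0 < q)
  have hrad : 1 / ((q : ℝ) * N) ≤ 1 / q := by
    gcongr
    nlinarith
  ext y
  simp only [approxSet, reducedApproxSet, Set.mem_inter_iff, Set.mem_iUnion, Set.mem_ofPred_eq,
    mem_filter, mem_range, exists_prop, fractionInterval]
  constructor
  · rintro ⟨-, x, ⟨hxq, hc⟩, hy⟩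
    refine ⟨x, ⟨lt_of_le_of_ne hxq ?_, hc⟩, hy⟩
    rintro rfl
    rw [Nat.gcd_self] at hc
    omega
  · rintro ⟨x, ⟨hxq, hc⟩, hy⟩
    refine ⟨?_, x, ⟨hxq.le, hc⟩, hy⟩
    have hx0 : 1 ≤ x := by
      rcases Nat.eq_zero_or_pos x with rfl | h
      · rw [Nat.coprime_zero_left] at hc; omega
      · exact h
    have h1 : 1 / (q : ℝ) ≤ x / q := by
      gcongr
      exact_mod_cast hx0
    have h2 : (x : ℝ) / q + 1 / q ≤ 1 := by
      rw [← add_div, div_le_one hq0]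
      exact_mod_cast hxq
    rw [Set.mem_Ioo] at hy
    rw [Set.mem_Icc]
    constructor <;> linarith

theorem measurableSet_approxSet {N : ℝ} (hN : 2 ≤ N) {q : ℕ} (hq : 2 ≤ q) :
    MeasurableSet (approxSet N q) := by
  rw [approxSet_eq_biUnion hN hq]
  exact Finset.measurableSet_biUnion _ fun _ _ => measurableSet_Ioo

theorem volume_real_fractionInterval {N : ℝ} (hN : 0 < N) (q x : ℕ) :
    volume.real (fractionInterval N q x) = 2 / (q * N) := by
  rw [fractionInterval, Real.volume_real_Ioo_of_le]
  · ring
  · have : 0 ≤ 1 / ((q : ℝ) * N) := by positivity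
    linarith

theorem volume_real_approxSet {N : ℝ} (hN : 2 ≤ N) {q : ℕ} (hq : 2 ≤ q) :
    volume.real (approxSet N q) = 2 / N * ((q.totient : ℝ) / q) := by
  have hN0 : 0 < N := by linarith
  have hq0 : (0 : ℝ) < q := by exact_mod_cast (by omega : 0 < q)
  have hfin : ∀ x ∈ (range q).filter (·.Coprime q), volume (fractionInterval N q x) ≠ ⊤ :=
    fun x _ => measure_Ioo_lt_top.ne
  rw [approxSet_eq_biUnion hN hq, measureReal_biUnion_finset (h := hfin)]
  · rw [sum_congr rfl fun x _ => volume_real_fractionInterval hN0 q x, sum_const, nsmul_eq_mul,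
      Nat.totient_eq_card_coprime]
    simp only [Nat.coprime_comm]
    field_simp
  · have hlt : ∀ x y : ℕ, x < y → Disjoint (fractionInterval N q x) (fractionInterval N q y) := by
      intro x y hxy
      have h1 : (x : ℝ) + 1 ≤ y := by exact_mod_cast hxy
      have h2 : (x : ℝ) / q + 1 / q ≤ y / q := by rw [← add_div]; gcongr
      have h3 : 1 / ((q : ℝ) * N) + 1 / (q * N) ≤ 1 / q := by
        rw [← add_div, div_le_div_iff₀ (by positivity) hq0]
        nlinarith
      rw [Set.disjoint_left]
      intro z hz hz'
      rw [fractionInterval, Set.mem_Ioo] at hz hz'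
      linarith [hz.2, hz'.1]
    intro x _ y _ hxy
    rcases lt_or_gt_of_ne hxy with h | h
    · exact hlt x y h
    · exact (hlt y x h).symm
  · exact fun _ _ => measurableSet_Ioo

/-- Intersecting intervals have centres closer than 1/(qN) + 1/(rN); multiplied by gab this is (q +
r)/(Ng) ≤ 4Q/(Ng). Each such pair contributes at most one full interval. -/
theorem volume_real_inter_le {Q N : ℝ} (hN : 2 ≤ N) (hQ : 0 < Q) {g a b : ℕ}
    (hq2 : 2 ≤ g * a) (hr2 : 2 ≤ g * b)
    (hq : Q ≤ (g * a : ℕ) ∧ ((g * a : ℕ) : ℝ) ≤ 2 * Q)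
    (hr : ((g * b : ℕ) : ℝ) ≤ 2 * Q) :
    volume.real (approxSet N (g * a) ∩ approxSet N (g * b)) ≤
      (nearPairs g a b (4 * (Q / (N * g)))).card * (2 / (Q * N)) := by
  have hN0 : 0 < N := by linarith
  have hg : 0 < g := Nat.pos_of_ne_zero fun h => by simp [h] at hq2
  have ha : 0 < a := Nat.pos_of_ne_zero fun h => by simp [h] at hq2
  have hb : 0 < b := Nat.pos_of_ne_zero fun h => by simp [h] at hr2
  have hg' : (0 : ℝ) < g := by exact_mod_cast hg
  have ha' : (0 : ℝ) < a := by exact_mod_cast ha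
  have hb' : (0 : ℝ) < b := by exact_mod_cast hb
  push_cast at hq hr
  have hsub : approxSet N (g * a) ∩ approxSet N (g * b) ⊆
      ⋃ z ∈ nearPairs g a b (4 * (Q / (N * g))), fractionInterval N (g * a) z.1 := by
    rw [approxSet_eq_biUnion hN hq2, approxSet_eq_biUnion hN hr2]
    rintro u ⟨hu, hu'⟩
    simp only [Set.mem_iUnion, mem_filter, mem_range, exists_prop] at hu hu' ⊢
    obtain ⟨x, ⟨hxq, hx⟩, hux⟩ := hu
    obtain ⟨y, ⟨hyr, hy⟩, huy⟩ := hu'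
    refine ⟨(x, y), ?_, hux⟩
    rw [nearPairs, mem_filter, mem_product, mem_range, mem_range]
    refine ⟨⟨hxq, hyr⟩, hx, hy, ?_⟩
    rw [fractionInterval, Set.mem_Ioo] at hux huy
    push_cast at hux huy
    have e1 : (x : ℝ) * b = g * a * b * (x / (g * a)) := by field_simp
    have e2 : (y : ℝ) * a = g * a * b * (y / (g * b)) := by field_simp
    have hclose : |(x : ℝ) / (g * a) - y / (g * b)| < 1 / (g * a * N) + 1 / (g * b * N) := by
      rw [abs_lt]
      constructor <;> linarith [hux.1, hux.2, huy.1, huy.2]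
    have hgab : (0 : ℝ) < g * a * b := by positivity
    dsimp only
    rw [e1, e2, ← mul_sub, abs_mul, abs_of_pos hgab]
    calc _ < g * a * b * (1 / (g * a * N) + 1 / (g * b * N)) := by gcongr
      _ = (g * a + g * b) / (N * g) := by field_simp; ring
      _ ≤ (4 * Q) / (N * g) := by gcongr; linarith
      _ = _ := by ring
  have hfin : volume (⋃ z ∈ nearPairs g a b (4 * (Q / (N * g))),
      fractionInterval N (g * a) z.1) ≠ ⊤ := by
    refine ((measure_biUnion_finset_le _ _).trans_lt (ENNReal.sum_lt_top.2 fun z _ => ?_)).ne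
    exact measure_Ioo_lt_top
  calc _ ≤ volume.real (⋃ z ∈ nearPairs g a b (4 * (Q / (N * g))),
        fractionInterval N (g * a) z.1) := measureReal_mono hsub hfin
    _ ≤ ∑ z ∈ nearPairs g a b (4 * (Q / (N * g))),
        volume.real (fractionInterval N (g * a) z.1) := measureReal_biUnion_finset_le _ _
    _ ≤ ∑ z ∈ nearPairs g a b (4 * (Q / (N * g))), 2 / (Q * N) := by
        refine sum_le_sum fun z _ => ?_
        rw [volume_real_fractionInterval hN0]
        push_cast
        gcongr
        exact hq.1
    _ = _ := by rw [sum_const, nsmul_eq_mul]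

theorem density_primeFactors_mul {g a : ℕ} (hga : Squarefree (g * a)) :
    density (g * a).primeFactors = density g.primeFactors * density a.primeFactors := by
  have hc := Nat.coprime_of_squarefree_mul hga
  rw [hc.primeFactors_mul, density, prod_union hc.disjoint_primeFactors]
  rfl

/-- The overlap estimate for two approximation sets. -/
theorem exists_overlap_le : ∃ C : ℝ, 0 < C ∧ ∀ (Q N : ℝ), 2 ≤ N → 2 ≤ Q → ∀ q r : ℕ, q ≠ r →
    (Q ≤ q ∧ (q : ℝ) ≤ 2 * Q ∧ Squarefree q) → (Q ≤ r ∧ (r : ℝ) ≤ 2 * Q ∧ Squarefree r) →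
    volume.real (approxSet N q ∩ approxSet N r) ≤
      C / N ^ 2 * ((q.totient : ℝ) / q * ((r.totient : ℝ) / r) *
        Real.exp (recipSum (Real.log (Q / (N * (Nat.gcd q r : ℝ))) / 6)
          (symmDiff q.primeFactors r.primeFactors))) := by
  obtain ⟨C, hC, hnear⟩ := exists_card_nearPairs_le
  refine ⟨8 * C, by positivity, fun Q N hN hQ q r hqr hq hr => ?_⟩
  have hN0 : 0 < N := by linarith
  have hQ0 : 0 < Q := by linarith
  have hq2 : 2 ≤ q := by exact_mod_cast hQ.trans hq.1
  have hr2 : 2 ≤ r := by exact_mod_cast hQ.trans hr.1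
  have hg : 0 < Nat.gcd q r := Nat.gcd_pos_of_pos_left _ (by omega)
  have hU : (q / Nat.gcd q r).primeFactors ∪ (r / Nat.gcd q r).primeFactors =
      symmDiff q.primeFactors r.primeFactors := by
    rw [primeFactors_div_gcd hq.2.2 hr.2.2.ne_zero, Nat.gcd_comm,
      primeFactors_div_gcd hr.2.2 hq.2.2.ne_zero]
    rfl
  have hab : (q / Nat.gcd q r).Coprime (r / Nat.gcd q r) := Nat.coprime_div_gcd_div_gcd hg
  have hqe : Nat.gcd q r * (q / Nat.gcd q r) = q := Nat.mul_div_cancel' (Nat.gcd_dvd_left q r)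
  have hre : Nat.gcd q r * (r / Nat.gcd q r) = r := Nat.mul_div_cancel' (Nat.gcd_dvd_right q r)
  rw [← density_primeFactors hq.2.2.ne_zero, ← density_primeFactors hr.2.2.ne_zero, ← hU]
  generalize Nat.gcd q r = g at *
  generalize q / g = a at *
  generalize r / g = b at *
  subst hqe hre
  have hg' : (0 : ℝ) < g := by exact_mod_cast hg
  have hgD : 0 < Q / (N * g) := by positivity
  have h1 := volume_real_inter_le hN hQ0 hq2 hr2 ⟨hq.1, hq.2.1⟩ hr.2.1
  have h2 := hnear g a b hq.2.2 hr.2.2 hab (fun h => hqr (by rw [h])) (4 * (Q / (N * g)))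
    (by positivity)
  have hUp : IsPrimeSet (a.primeFactors ∪ b.primeFactors) := fun p hp => (mem_union.1 hp).elim
    (fun h => Nat.prime_of_mem_primeFactors h) fun h => Nat.prime_of_mem_primeFactors h
  have hUd : density (a.primeFactors ∪ b.primeFactors) =
      density a.primeFactors * density b.primeFactors := prod_union hab.disjoint_primeFactors
  -- Dropping the factor 4 lowers the threshold and only enlarges the sum, matching the second
  -- moment.
  have hlog : recipSum (Real.log (4 * (Q / (N * g))) / 6) (a.primeFactors ∪ b.primeFactors) ≤
      recipSum (Real.log (Q / (N * g)) / 6) (a.primeFactors ∪ b.primeFactors) := by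
    refine recipSum_anti ?_ _
    have := Real.log_le_log hgD (by linarith : Q / (N * g) ≤ 4 * (Q / (N * g)))
    linarith
  have hgp := (isPrimeSet_primeFactors g).density_pos
  have hUpos := hUp.density_pos
  calc _ ≤ _ := h1
    _ ≤ C * (density g.primeFactors ^ 2 * g) *
        (4 * (Q / (N * g)) * (density (a.primeFactors ∪ b.primeFactors) *
          Real.exp (recipSum (Real.log (Q / (N * g)) / 6)
            (a.primeFactors ∪ b.primeFactors)))) * (2 / (Q * N)) := by
        gcongr
        exact h2.trans (by gcongr)
    _ = _ := by
        rw [density_primeFactors_mul hq.2.2, density_primeFactors_mul hr.2.2, hUd]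
        field_simp
        ring

/-- A Chung–Erdős type lower bound for the measure of a finite union. -/
theorem measureReal_biUnion_lower_bound {α ι : Type*} [MeasurableSpace α] (μ : Measure α)
    (S : Finset ι) (A : ι → Set α) (hA : ∀ i ∈ S, MeasurableSet (A i))
    (hfin : ∀ i ∈ S, μ (A i) ≠ ⊤) (c : ℝ) :
    2 * c * ∑ i ∈ S, μ.real (A i) - c ^ 2 * ∑ i ∈ S, ∑ j ∈ S, μ.real (A i ∩ A j) ≤
      μ.real (⋃ i ∈ S, A i) := by
  set χ : Set α → α → ℝ := fun s => s.indicator 1 with hχ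
  have hint : ∀ s : Set α, MeasurableSet s → μ s ≠ ⊤ → Integrable (χ s) μ := fun s hs hμ =>
    (integrableOn_const (C := (1 : ℝ)) hμ).integrable_indicator hs
  have hval : ∀ s : Set α, MeasurableSet s → ∫ x, χ s x ∂μ = μ.real s := fun s hs =>
    integral_indicator_one hs
  have hUmeas : MeasurableSet (⋃ i ∈ S, A i) := Finset.measurableSet_biUnion _ hA
  have hUfin : μ (⋃ i ∈ S, A i) ≠ ⊤ := ((measure_biUnion_finset_le _ _).trans_lt
    (ENNReal.sum_lt_top.2 fun i hi => (hfin i hi).lt_top)).ne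
  have hint1 : Integrable (fun x => ∑ i ∈ S, χ (A i) x) μ :=
    integrable_finsetSum _ fun i hi => hint _ (hA i hi) (hfin i hi)
  have hij : ∀ i ∈ S, ∀ j ∈ S, Integrable (χ (A i ∩ A j)) μ := fun i hi j hj =>
    hint _ ((hA i hi).inter (hA j hj)) (measure_ne_top_of_subset Set.inter_subset_left (hfin i hi))
  have hint2 : Integrable (fun x => ∑ i ∈ S, ∑ j ∈ S, χ (A i ∩ A j) x) μ :=
    integrable_finsetSum _ fun i hi => integrable_finsetSum _ fun j hj => hij i hi j hj
  have hpt : ∀ x, 2 * c * ∑ i ∈ S, χ (A i) x - c ^ 2 * ∑ i ∈ S, ∑ j ∈ S, χ (A i ∩ A j) x ≤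
      χ (⋃ i ∈ S, A i) x := by
    intro x
    have h1 : ∑ i ∈ S, ∑ j ∈ S, χ (A i ∩ A j) x = (∑ i ∈ S, χ (A i) x) ^ 2 := by
      rw [sq, sum_mul_sum]
      refine sum_congr rfl fun i _ => sum_congr rfl fun j _ => ?_
      simp only [hχ, Set.inter_indicator_one, Pi.mul_apply]
    rw [h1]
    by_cases hx : x ∈ ⋃ i ∈ S, A i
    · have : χ (⋃ i ∈ S, A i) x = 1 := Set.indicator_of_mem hx _
      rw [this]
      -- With F the number of sets containing x, this is 2cF - c²F² ≤ 1.
      nlinarith [sq_nonneg (1 - c * ∑ i ∈ S, χ (A i) x)]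
    · have h2 : ∑ i ∈ S, χ (A i) x = 0 := sum_eq_zero fun i hi =>
        Set.indicator_of_notMem (fun h => hx (Set.mem_biUnion hi h)) _
      have : χ (⋃ i ∈ S, A i) x = 0 := Set.indicator_of_notMem hx _
      rw [this, h2]
      simp
  have h := integral_mono ((hint1.const_mul (2 * c)).sub (hint2.const_mul (c ^ 2)))
    (hint _ hUmeas hUfin) hpt
  rw [hval _ hUmeas] at h
  refine le_of_eq_of_le ?_ h
  rw [← sum_congr rfl fun i hi => hval _ (hA i hi), ← integral_finsetSum _ fun i hi =>
    hint _ (hA i hi) (hfin i hi)]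
  have e2 : ∑ i ∈ S, ∑ j ∈ S, μ.real (A i ∩ A j) =
      ∫ x, ∑ i ∈ S, ∑ j ∈ S, χ (A i ∩ A j) x ∂μ := by
    rw [integral_finsetSum _ fun i hi => integrable_finsetSum _ fun j hj => hij i hi j hj]
    refine sum_congr rfl fun i hi => ?_
    rw [integral_finsetSum _ fun j hj => hij i hi j hj]
    exact sum_congr rfl fun j hj => (hval _ ((hA i hi).inter (hA j hj))).symm
  rw [e2, ← integral_const_mul, ← integral_const_mul]
  exact (integral_sub (hint1.const_mul (2 * c)) (hint2.const_mul (c ^ 2))).symm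

/-- The union of the approximation sets has measure bounded below. -/
theorem exists_measure_union_ge : ∃ c : ℝ, 0 < c ∧
    ∀ (Q N : ℝ) (S : Finset ℕ), 2 ≤ N → N ≤ Q →
      (∀ q ∈ S, Q ≤ (q : ℝ) ∧ (q : ℝ) ≤ 2 * Q ∧ Squarefree q) →
      N / 2 ≤ ∑ q ∈ S, (Nat.totient q : ℝ) / (q : ℝ) →
      ∑ q ∈ S, (Nat.totient q : ℝ) / (q : ℝ) ≤ N →
      c ≤ volume.real (⋃ q ∈ S, approxSet N q) := by
  obtain ⟨C, hC, hsecond⟩ := exists_second_moment_le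
  obtain ⟨C', hC', hover⟩ := exists_overlap_le
  set M := 2 + C' * C with hM
  have hM0 : 0 < M := by positivity
  refine ⟨1 / M, by positivity, fun Q N S hN hNQ hS hlow hup => ?_⟩
  have hN0 : 0 < N := by linarith
  have hQ : 2 ≤ Q := hN.trans hNQ
  have hq2 : ∀ q ∈ S, 2 ≤ q := fun q hq => by exact_mod_cast hQ.trans (hS q hq).1
  have hfin : ∀ q ∈ S, volume (approxSet N q) ≠ ⊤ := fun q _ =>
    measure_ne_top_of_subset Set.inter_subset_left measure_Icc_lt_top.ne
  have hS1 : ∑ q ∈ S, volume.real (approxSet N q) =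
      2 / N * ∑ q ∈ S, (Nat.totient q : ℝ) / (q : ℝ) := by
    rw [mul_sum]
    exact sum_congr rfl fun q hq => volume_real_approxSet hN (hq2 q hq)
  have hlow1 : 1 ≤ ∑ q ∈ S, volume.real (approxSet N q) := by
    rw [hS1]
    calc (1 : ℝ) = 2 / N * (N / 2) := by field_simp
      _ ≤ _ := by gcongr
  have hup1 : ∑ q ∈ S, volume.real (approxSet N q) ≤ 2 := by
    rw [hS1]
    calc _ ≤ 2 / N * N := by gcongr
      _ = 2 := by field_simp
  have hpair : ∀ q ∈ S, ∀ r ∈ S, volume.real (approxSet N q ∩ approxSet N r) ≤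
      (if q = r then volume.real (approxSet N q) else 0) +
      C' / N ^ 2 * ((q.totient : ℝ) / q * ((r.totient : ℝ) / r) *
        Real.exp (recipSum (Real.log (Q / (N * (Nat.gcd q r : ℝ))) / 6)
          (symmDiff q.primeFactors r.primeFactors))) := by
    intro q hq r hr
    split_ifs with h
    · subst h
      rw [Set.inter_self]
      exact le_add_of_nonneg_right (by positivity)
    · rw [zero_add]
      exact hover Q N hN hQ q r h (hS q hq) (hS r hr)
  have hS2 : ∑ q ∈ S, ∑ r ∈ S, volume.real (approxSet N q ∩ approxSet N r) ≤ M := by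
    calc _ ≤ ∑ q ∈ S, ∑ r ∈ S, ((if q = r then volume.real (approxSet N q) else 0) +
          C' / N ^ 2 * ((q.totient : ℝ) / q * ((r.totient : ℝ) / r) *
          Real.exp (recipSum (Real.log (Q / (N * (Nat.gcd q r : ℝ))) / 6)
            (symmDiff q.primeFactors r.primeFactors)))) :=
          sum_le_sum fun q hq => sum_le_sum fun r hr => hpair q hq r hr
      _ = ∑ q ∈ S, volume.real (approxSet N q) + C' / N ^ 2 * ∑ q ∈ S, ∑ r ∈ S,
          ((q.totient : ℝ) / q * ((r.totient : ℝ) / r) *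
          Real.exp (recipSum (Real.log (Q / (N * (Nat.gcd q r : ℝ))) / 6)
            (symmDiff q.primeFactors r.primeFactors))) := by
          simp only [sum_add_distrib, mul_sum]
          congr 1
          refine sum_congr rfl fun q hq => ?_
          rw [sum_ite_eq, if_pos hq]
      _ ≤ 2 + C' / N ^ 2 * (C * N ^ 2) := by
          gcongr
          exact hsecond Q N S hN0 (by linarith) (fun q hq => (hS q hq).2) hup
      _ = M := by rw [hM]; field_simp
  have hb := measureReal_biUnion_lower_bound volume S (approxSet N)
    (fun q hq => measurableSet_approxSet hN (hq2 q hq)) hfin (1 / M)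
  -- With first moment at least 1 and second moment at most M, the choice c = 1/M maximises 2c -
  -- c²M.
  calc 1 / M = 2 * (1 / M) * 1 - (1 / M) ^ 2 * M := by field_simp; norm_num
    _ ≤ 2 * (1 / M) * ∑ q ∈ S, volume.real (approxSet N q) -
        (1 / M) ^ 2 * ∑ q ∈ S, ∑ r ∈ S, volume.real (approxSet N q ∩ approxSet N r) := by gcongr
    _ ≤ _ := hb

end DuffinSchaeffer

theorem mainTheorem1 :
    ∃ C c : ℝ, 0 < C ∧ 0 < c ∧
      ∀ (Q N : ℝ) (S : Finset ℕ), 2 ≤ N → N ≤ Q →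
        (∀ q ∈ S, Q ≤ (q : ℝ) ∧ (q : ℝ) ≤ 2 * Q ∧ Squarefree q) →
        N / 2 ≤ ∑ q ∈ S, (Nat.totient q : ℝ) / (q : ℝ) →
        ∑ q ∈ S, (Nat.totient q : ℝ) / (q : ℝ) ≤ N →
        (∑ q ∈ S, ∑ r ∈ S,
            ((Nat.totient q : ℝ) * (Nat.totient r : ℝ)) / ((q : ℝ) * (r : ℝ)) *
              Real.exp (primeRecipSum (q * r / Nat.gcd q r ^ 2)
                (Q / (N * (Nat.gcd q r : ℝ)))) ≤ C * N ^ 2) ∧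
        ENNReal.ofReal c ≤
          MeasureTheory.volume
            (⋃ q ∈ S, reducedApproxSet (fun k => 1 / ((k : ℝ) * N)) q) := by
  obtain ⟨C, hC, hsecond⟩ := DuffinSchaeffer.exists_second_moment_le
  obtain ⟨c, hc, hmeas⟩ := DuffinSchaeffer.exists_measure_union_ge
  refine ⟨C, c, hC, hc, fun Q N S hN hNQ hS hlow hup => ⟨?_, ?_⟩⟩
  · refine le_trans (Finset.sum_le_sum fun q hq => Finset.sum_le_sum fun r hr => ?_)
      (hsecond Q N S (by linarith) (by linarith) (fun q hq => (hS q hq).2) hup)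
    have hN0 : 0 < N := by linarith
    have hg : (0 : ℝ) < Nat.gcd q r := by
      exact_mod_cast Nat.gcd_pos_of_pos_left _ (Nat.pos_of_ne_zero (hS q hq).2.2.ne_zero)
    have hD : 0 < Q / (N * (Nat.gcd q r : ℝ)) := div_pos (by linarith) (by positivity)
    rw [DuffinSchaeffer.primeRecipSum_eq (hS q hq).2.2 (hS r hr).2.2, mul_div_mul_comm]
    gcongr
    refine DuffinSchaeffer.recipSum_anti ?_ _
    -- The stated threshold x = Q/(N gcd) exceeds (log x)/6, so its sum runs over fewer primes.
    have hlog := Real.log_le_sub_one_of_pos hD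
    linarith
  · refine ENNReal.ofReal_le_of_le_toReal ?_
    exact hmeas Q N S hN hNQ hS hlow hup
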